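/- Let $p>5$ be a prime, let $n=2m$ be even, and let $r,s\ge 0$ be integers with $r+s=m-2$ (so $m\ge 2$). For $t,u_1,\dots,u_s\in\{0,\dots,p-1\}$ with $t\ne 0$, let $D(t,u_1,\dots,u_s)=\sum_{i=0}^{n-1} d_i p^i$ be the integer whose base-$p$ digits $(d_0,d_1,\dots,d_{n-1})$, least significant first, are $$(\underbrace{0,\dots,0}_{r},\,t,\,u_1,\dots,u_s,\,1,\,\underbrace{0,\dots,0}_{r},\,p-t,\,p-1-u_1,\dots,p-1-u_s,\,0).$$ Then the monomial $X^{D(t,u_1,\dots,u_s)}$ is not planar over $\mathbb{F}_{p^n}$; that is, for $d=D(t,u_1,\dots,u_s)$ there is a non-zero $\alpha\in\mathbb{F}_{p^n}$ such that the map $x\mapsto (x+\alpha)^d-x^d-\alpha^d$ is not a permutation of $\mathbb{F}_{p^n}$. -/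

import Mathlib

/-- A function `F` on a field is planar if `x ↦ F (x + α) - F x - F α` is a permutation of the field for
every non-zero `α`. -/
def IsPlanarFunction {K : Type*} [Field K] (F : K → K) : Prop :=
  ∀ α : K, α ≠ 0 → Function.Bijective fun x : K => F (x + α) - F x - F α

/-- A polynomial is planar if its evaluation map is planar. -/
def IsPlanarPolynomial {K : Type*} [Field K] (P : Polynomial K) : Prop :=
  IsPlanarFunction fun x : K => P.eval x

/-- The base-`p` digits of `D(t, u₁, …, uₛ)`, least significant digit first:
`(0, …, 0, t, u₁, …, uₛ, 1, 0, …, 0, p - t, p - 1 - u₁, …, p - 1 - uₛ, 0)`, where both blocks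
of zeros have length `r`. There are `2 (r + s + 2)` digits in total. -/
def exponentDigits (p r s : ℕ) (t : Fin p) (u : Fin s → Fin p) : List ℕ :=
  List.replicate r 0 ++ [(t : ℕ)] ++ List.ofFn (fun i => (u i : ℕ)) ++ [1] ++
    (List.replicate r 0 ++ [p - (t : ℕ)] ++ List.ofFn (fun i => p - 1 - (u i : ℕ)) ++ [0])

/-- The integer `D(t, u₁, …, uₛ)` with the digits above. -/
def exponentD (p r s : ℕ) (t : Fin p) (u : Fin s → Fin p) : ℕ :=
  Nat.ofDigits p (exponentDigits p r s t u)

open Finset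

section Planar

variable {K : Type*} [Field K]

theorem IsPlanarFunction.pow_mul_char_pow [Finite K] (p : ℕ) [Fact p.Prime] [CharP K p] {d : ℕ} (k : ℕ)
    (h : IsPlanarFunction fun x : K => x ^ d) :
    IsPlanarFunction fun x : K => x ^ (d * p ^ k) := by
  intro α hα
  have hinj : Function.Injective fun x : K => x ^ p ^ k := by
    have := iterateFrobenius_inj K p k
    intro x y hxy
    exact this (by simpa [iterateFrobenius_def] using hxy)
  have hb : Function.Bijective fun x : K => x ^ p ^ k := Finite.injective_iff_bijective.mp hinj
  have := hb.comp (h α hα)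
  convert this using 2 with x
  simp only [Function.comp, pow_mul]
  rw [sub_pow_char_pow, sub_pow_char_pow]

theorem sum_pow_eq_ite [Fintype K] {e : ℕ} (he : e ≠ 0) :
    ∑ x : K, x ^ e = if Fintype.card K - 1 ∣ e then -1 else 0 := by
  classical
  rw [← FiniteField.sum_pow_units K e, ← Finset.sum_sdiff (Finset.subset_univ {(0 : K)})]
  simp only [sum_singleton, zero_pow he, add_zero]
  symm
  refine Finset.sum_bij (fun u _ => (u : K)) (by simp) (by simp [Units.ext_iff]) ?_ (by simp)
  intro x hx
  have hx0 : x ≠ 0 := by simpa using hx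
  exact ⟨Units.mk0 x hx0, mem_univ _, rfl⟩

theorem dvd_exponent_iff {Q D b : ℤ} (hQ : 1 < Q)
    (hD : Q ^ 2 - 1 ∣ D - (1 + Q) + b * (Q - 1)) (i j μ ν : ℤ) :
    Q ^ 2 - 1 ∣ D * (i + Q * j) + μ + Q * ν ↔
      ∃ r : ℤ, 2 * (i + j) + μ + ν = r * (Q - 1) ∧
        2 * (Q + 1) ∣ r * (Q + 1) + (ν - μ) - 2 * b * (i - j) := by
  have hred : Q ^ 2 - 1 ∣ D * (i + Q * j) + μ + Q * ν ↔
      Q ^ 2 - 1 ∣ (1 + Q) * (i + j) - b * (Q - 1) * (i - j) + μ + Q * ν := by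
    have : Q ^ 2 - 1 ∣ (D * (i + Q * j) + μ + Q * ν) -
        ((1 + Q) * (i + j) - b * (Q - 1) * (i - j) + μ + Q * ν) := by
      have e : (D * (i + Q * j) + μ + Q * ν) -
        ((1 + Q) * (i + j) - b * (Q - 1) * (i - j) + μ + Q * ν) =
        (D - (1 + Q) + b * (Q - 1)) * (i + Q * j) + (Q ^ 2 - 1) * (j - b * j) := by ring
      rw [e]
      exact dvd_add (hD.mul_right _) (dvd_mul_right _ _)
    exact dvd_iff_dvd_of_dvd_sub this
  rw [hred]
  have hQ1 : Q - 1 ≠ 0 := by omega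
  constructor
  · intro hE
    have h1 : Q - 1 ∣ 2 * (i + j) + μ + ν := by
      have h2 : Q - 1 ∣ (1 + Q) * (i + j) - b * (Q - 1) * (i - j) + μ + Q * ν :=
        (Dvd.intro (Q + 1) (by ring)).trans hE
      have : 2 * (i + j) + μ + ν = ((1 + Q) * (i + j) - b * (Q - 1) * (i - j) + μ + Q * ν) -
        (Q - 1) * ((i + j) + ν - b * (i - j)) := by ring
      rw [this]
      exact dvd_sub h2 (dvd_mul_right _ _)
    obtain ⟨r, hr⟩ := h1
    refine ⟨r, by rw [hr]; ring, ?_⟩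
    obtain ⟨k, hk⟩ := hE
    refine ⟨k, mul_left_cancel₀ hQ1 ?_⟩
    linear_combination 2 * hk - (1 + Q) * hr
  · rintro ⟨r, hr, k, hk⟩
    refine ⟨k, mul_left_cancel₀ (two_ne_zero) ?_⟩
    linear_combination (Q - 1) * hk + (1 + Q) * hr

theorem not_planar_of_pow_eq_one {D : ℕ} (hDe : Even D) {v : K}
    (hv : v ^ D = 1) (hv1 : v ≠ 1) (hv2 : v ≠ -1) : ¬ IsPlanarFunction fun x : K => x ^ D := by
  intro h
  have hα : v - 1 ≠ 0 := sub_ne_zero.mpr hv1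
  have := (h (v - 1) hα).1 (a₁ := 1) (a₂ := -v) (by
    have e1 : (1 : K) + (v - 1) = v := by ring
    have e2 : -v + (v - 1) = -1 := by ring
    simp only [e1, e2, hDe.neg_pow, one_pow, hv])
  exact hv2 (by rw [this]; ring)

/-- The second-order norm sum attached to a planar monomial. -/
theorem sum_norm_pow_eq_neg_one [Fintype K] {p Q m : ℕ} [Fact p.Prime] [CharP K p] (hQp : Q = p ^ m)
    (hcard : Fintype.card K = Q ^ 2) (hQ : 1 < Q)
    {D c A ε : ℕ} {b : ℤ} (hD : (Q : ℤ) ^ 2 - 1 ∣ D - (1 + Q) + b * (Q - 1)) (hD0 : D ≠ 0)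
    (hpl : IsPlanarFunction fun x : K => x ^ D)
    (hAQ : A < Q - 1) (hε : 0 < ε) (hc : 2 * A + ε = c * (Q - 1)) :
    ∑ w : K, (w ^ D - 1) ^ ((1 + Q) * A) * (w - 1) ^ ((1 + Q) * ε) = -1 := by
  classical
  have hq : Q ^ 2 - 1 = (Q - 1) * (1 + Q) := by
    zify [hQ.le, Nat.one_le_pow 2 Q (by omega)]; ring
  have hsum : ∑ x : K, ((x + 1) ^ D - x ^ D) ^ ((1 + Q) * A) = 0 := by
    have hbij : Function.Bijective fun x : K => (x + 1) ^ D - x ^ D := by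
      have h1 := hpl 1 one_ne_zero
      have h2 := (Equiv.addRight (1 : K)).bijective.comp h1
      convert h2 using 2 with x
      simp
    have := hbij.sum_comp (fun y : K => y ^ ((1 + Q) * A))
    rw [this]
    apply FiniteField.sum_pow_lt_card_sub_one
    rw [hcard, hq, mul_comm (Q - 1)]
    exact Nat.mul_lt_mul_of_pos_left hAQ (by omega)
  let e : K ≃ K := (Equiv.inv K).trans (Equiv.addLeft 1)
  rw [← e.sum_comp]
  have hx1 : ∀ x : K, x ≠ 0 → x ^ ((Q - 1) * (1 + Q)) = 1 := by
    intro x hx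
    rw [← hq, ← hcard]
    exact FiniteField.pow_card_sub_one_eq_one x hx
  have hterm : ∀ x : K, (e x ^ D - 1) ^ ((1 + Q) * A) * (e x - 1) ^ ((1 + Q) * ε) =
      (if x = 0 then 0 else ((x + 1) ^ D - x ^ D) ^ ((1 + Q) * A)) := by
    intro x
    have he : e x = 1 + x⁻¹ := rfl
    rw [he]
    split_ifs with hx
    · simp [hx, hε.ne']
    · have h1 : (1 + x⁻¹) ^ D - 1 = ((x + 1) ^ D - x ^ D) * (x⁻¹) ^ D := by
        rw [sub_mul, ← mul_pow, ← mul_pow, mul_inv_cancel₀ hx, add_mul, mul_inv_cancel₀ hx]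
        simp
      rw [h1, add_sub_cancel_left, mul_pow, mul_assoc, ← pow_mul, ← pow_add]
      have h2 : (x⁻¹) ^ (D * ((1 + Q) * A) + (1 + Q) * ε) = 1 := by
        have h3 : (Q - 1) * (1 + Q) ∣ D * ((1 + Q) * A) + (1 + Q) * ε := by
          have : D * ((1 + Q) * A) + (1 + Q) * ε = (D * A + ε) * (1 + Q) := by ring
          rw [this]
          apply Nat.mul_dvd_mul_right
          zify [hQ.le]
          have h4 : (Q : ℤ) - 1 ∣ D - 2 := by
            have h5 : (Q : ℤ) - 1 ∣ D - (1 + Q) + b * (Q - 1) :=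
              (Dvd.intro ((Q : ℤ) + 1) (by ring)).trans hD
            have h6 : (D : ℤ) - 2 = (D - (1 + Q) + b * (Q - 1)) + (Q - 1) * (1 - b) := by ring
            rw [h6]; exact dvd_add h5 (dvd_mul_right _ _)
          have h7 : (D : ℤ) * A + ε = (D - 2) * A + c * (Q - 1) := by
            have : (2 * A + ε : ℤ) = c * (Q - 1) := by
              have := congrArg (Nat.cast (R := ℤ)) hc
              push_cast [Nat.cast_sub hQ.le] at this
              exact this
            linear_combination this
          rw [h7]
          exact dvd_add (h4.mul_right _) (dvd_mul_left _ _)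
        obtain ⟨k, hk⟩ := h3
        rw [hk, pow_mul, hx1 _ (inv_ne_zero hx), one_pow]
      rw [h2, mul_one]
  rw [Finset.sum_congr rfl fun x _ => hterm x]
  rw [← Finset.add_sum_erase univ _ (mem_univ (0 : K))] at hsum ⊢
  simp only [zero_add, one_pow, zero_pow hD0, sub_zero, if_true] at hsum ⊢
  rw [Finset.sum_congr rfl (g := fun x : K => ((x + 1) ^ D - x ^ D) ^ ((1 + Q) * A))]
  · linear_combination hsum
  · intro x hx
    rw [if_neg (Finset.ne_of_mem_erase hx)]

theorem norm_pow_expand {p Q m : ℕ} [Fact p.Prime] [CharP K p] (hQp : Q = p ^ m) (x : K) (A : ℕ) :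
    (x - 1) ^ ((1 + Q) * A) = ∑ i ∈ range (A + 1), ∑ j ∈ range (A + 1),
      ((-1) ^ (i + j) * (A.choose i) * (A.choose j) : K) * x ^ (i + Q * j) := by
  have h1 : (x - 1) ^ ((1 + Q) * A) = (x - 1) ^ A * (x ^ Q - 1) ^ A := by
    rw [add_mul, one_mul, pow_add, pow_mul]
    congr 2
    rw [hQp, sub_pow_char_pow, one_pow]
  rw [h1, sub_pow, sub_pow, Finset.sum_mul_sum]
  refine Finset.sum_congr rfl fun i _ => Finset.sum_congr rfl fun j _ => ?_
  have h2 : (-1 : K) ^ (i + A) * (-1) ^ (j + A) = (-1) ^ (i + j) := by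
    rw [← pow_add, show i + A + (j + A) = i + j + 2 * A by ring, pow_add, pow_mul]; simp
  simp only [one_pow, mul_one]
  rw [← h2, pow_add x i, pow_mul]
  ring

theorem sum_range_four_ite_top {R : Type*} [CommRing R] (A ε : ℕ) :
    ∑ μ ∈ range (ε + 1), ∑ ν ∈ range (ε + 1), ∑ i ∈ range (A + 1), ∑ j ∈ range (A + 1),
      (if i = A ∧ j = A ∧ μ = ε ∧ ν = ε then
        ((-1) ^ (i + j + μ + ν) * A.choose i * A.choose j * ε.choose μ * ε.choose ν : R) else 0) = 1 := by
  rw [Finset.sum_eq_single ε, Finset.sum_eq_single ε, Finset.sum_eq_single A, Finset.sum_eq_single A]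
  · have : (-1 : R) ^ (A + A + ε + ε) = 1 := by
      rw [show A + A + ε + ε = 2 * (A + ε) by ring, pow_mul]; simp
    simp [this]
  · intro j _ hj; simp [hj]
  · simp
  · intro i _ hi; simp [hi]
  · simp
  · intro ν _ hν; simp [hν]
  · simp
  · intro μ _ hμ; simp [hμ]
  · simp

open Classical in
theorem planar_sum_eq_zero (K : Type*) [Field K] [Fintype K] {p Q m : ℕ} [Fact p.Prime] [CharP K p]
    (hQp : Q = p ^ m) (hcard : Fintype.card K = Q ^ 2) (hQ : 1 < Q)
    {D c A ε : ℕ} {b : ℤ} (hD : (Q : ℤ) ^ 2 - 1 ∣ D - (1 + Q) + b * (Q - 1)) (hD0 : D ≠ 0)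
    (hpl : IsPlanarFunction fun x : K => x ^ D)
    (hAQ : A < Q - 1) (hε : 0 < ε) (hc : 2 * A + ε = c * (Q - 1)) :
    ∑ μ ∈ range (ε + 1), ∑ ν ∈ range (ε + 1), ∑ i ∈ range (A + 1), ∑ j ∈ range (A + 1),
      (if ∃ r : ℤ, 0 < r ∧ r < 2 * c ∧ 2 * ((i : ℤ) + j) + μ + ν = r * (Q - 1) ∧
          2 * ((Q : ℤ) + 1) ∣ r * (Q + 1) + (ν - μ) - 2 * b * (i - j) then
        ((-1) ^ (i + j + μ + ν) * A.choose i * A.choose j * ε.choose μ * ε.choose ν : ZMod p)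
      else 0) = 0 := by
  apply ZMod.castHom_injective K
  simp only [map_sum, apply_ite (ZMod.castHom (dvd_refl p) K), map_mul, map_pow, map_neg, map_one,
    map_natCast, map_zero]
  have hmain := sum_norm_pow_eq_neg_one hQp hcard hQ hD hD0 hpl hAQ hε hc
  have hexp : ∀ w : K, (w ^ D - 1) ^ ((1 + Q) * A) * (w - 1) ^ ((1 + Q) * ε) =
      ∑ μ ∈ range (ε + 1), ∑ ν ∈ range (ε + 1), ∑ i ∈ range (A + 1), ∑ j ∈ range (A + 1),
        ((-1) ^ (i + j + μ + ν) * A.choose i * A.choose j * ε.choose μ * ε.choose ν : K) *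
          w ^ (D * (i + Q * j) + (μ + Q * ν)) := by
    intro w
    rw [norm_pow_expand hQp, norm_pow_expand hQp, mul_comm, Finset.sum_mul]
    refine Finset.sum_congr rfl fun μ _ => ?_
    rw [Finset.sum_mul]
    refine Finset.sum_congr rfl fun ν _ => ?_
    rw [Finset.mul_sum]
    refine Finset.sum_congr rfl fun i _ => ?_
    rw [Finset.mul_sum]
    refine Finset.sum_congr rfl fun j _ => ?_
    rw [← pow_mul, pow_add w, show i + j + μ + ν = (i + j) + (μ + ν) by ring, pow_add (-1 : K) (i + j)]
    ring
  rw [Finset.sum_congr rfl fun w _ => hexp w, Finset.sum_comm] at hmain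
  have hswap : ∀ μ ν i j : ℕ, ∑ w : K,
      ((-1) ^ (i + j + μ + ν) * A.choose i * A.choose j * ε.choose μ * ε.choose ν : K) *
          w ^ (D * (i + Q * j) + (μ + Q * ν)) =
      -(if D * (i + Q * j) + (μ + Q * ν) ≠ 0 ∧ Q ^ 2 - 1 ∣ D * (i + Q * j) + (μ + Q * ν) then
        ((-1) ^ (i + j + μ + ν) * A.choose i * A.choose j * ε.choose μ * ε.choose ν : K) else 0) := by
    intro μ ν i j
    rw [← Finset.mul_sum]
    by_cases h0 : D * (i + Q * j) + (μ + Q * ν) = 0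
    · rw [h0]
      simp only [pow_zero, sum_const, card_univ, hcard, hQp]
      have : m ≠ 0 := by rintro rfl; simp [hQp] at hQ
      simp [this, CharP.cast_eq_zero]
    · rw [sum_pow_eq_ite h0, hcard]
      by_cases h1 : Q ^ 2 - 1 ∣ D * (i + Q * j) + (μ + Q * ν)
      · rw [if_pos h1, if_pos ⟨h0, h1⟩]; ring
      · rw [if_neg h1, if_neg (fun h => h1 h.2)]; ring
  have hmain2 : ∑ μ ∈ range (ε + 1), ∑ ν ∈ range (ε + 1), ∑ i ∈ range (A + 1), ∑ j ∈ range (A + 1),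
      (if D * (i + Q * j) + (μ + Q * ν) ≠ 0 ∧ Q ^ 2 - 1 ∣ D * (i + Q * j) + (μ + Q * ν) then
        ((-1) ^ (i + j + μ + ν) * A.choose i * A.choose j * ε.choose μ * ε.choose ν : K) else 0) = 1 := by
    rw [← neg_inj]
    refine Eq.trans ?_ hmain
    simp only [← Finset.sum_neg_distrib]
    refine Finset.sum_congr rfl fun μ _ => ?_
    rw [Finset.sum_comm (s := univ)]
    refine Finset.sum_congr rfl fun ν _ => ?_
    rw [Finset.sum_comm (s := univ)]
    refine Finset.sum_congr rfl fun i _ => ?_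
    rw [Finset.sum_comm (s := univ)]
    refine Finset.sum_congr rfl fun j _ => ?_
    exact (hswap μ ν i j).symm
  refine Eq.trans ?_ (sub_eq_zero.mpr (hmain2.trans (sum_range_four_ite_top (R := K) A ε).symm))
  simp only [← Finset.sum_sub_distrib]
  refine Finset.sum_congr rfl fun μ hμ => Finset.sum_congr rfl fun ν hν =>
    Finset.sum_congr rfl fun i hi => Finset.sum_congr rfl fun j hj => ?_
  have hμ' := mem_range_succ_iff.mp hμ
  have hν' := mem_range_succ_iff.mp hν
  have hi' := mem_range_succ_iff.mp hi
  have hj' := mem_range_succ_iff.mp hj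
  have hcast : (2 * A + ε : ℤ) = c * (Q - 1) := by
    have := congrArg (Nat.cast (R := ℤ)) hc
    push_cast [Nat.cast_sub hQ.le] at this
    exact this
  have hQ' : (1 : ℤ) < Q := by exact_mod_cast hQ
  have hdvd : Q ^ 2 - 1 ∣ D * (i + Q * j) + (μ + Q * ν) ↔
      ∃ r : ℤ, 2 * ((i : ℤ) + j) + μ + ν = r * (Q - 1) ∧
        2 * ((Q : ℤ) + 1) ∣ r * (Q + 1) + (ν - μ) - 2 * b * (i - j) := by
    rw [← dvd_exponent_iff hQ' hD, ← Int.natCast_dvd_natCast]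
    push_cast [Nat.cast_sub (Nat.one_le_pow 2 Q (by omega))]
    rw [← add_assoc]
  by_cases htop : i = A ∧ j = A ∧ μ = ε ∧ ν = ε
  · obtain ⟨rfl, rfl, rfl, rfl⟩ := htop
    have h1 : ¬ ∃ r : ℤ, 0 < r ∧ r < 2 * c ∧ 2 * ((j : ℤ) + j) + ν + ν = r * (Q - 1) ∧
          2 * ((Q : ℤ) + 1) ∣ r * (Q + 1) + (ν - ν) - 2 * b * (j - j) := by
      rintro ⟨r, _, hr, h, _⟩
      have : r * (Q - 1) = (2 * c) * ((Q : ℤ) - 1) := by linear_combination 2 * hcast - h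
      have := mul_right_cancel₀ (by omega : (Q : ℤ) - 1 ≠ 0) this
      omega
    have h2 : D * (j + Q * j) + (ν + Q * ν) ≠ 0 ∧ Q ^ 2 - 1 ∣ D * (j + Q * j) + (ν + Q * ν) := by
      refine ⟨by omega, hdvd.mpr ⟨2 * c, by linear_combination 2 * hcast, ?_⟩⟩
      exact ⟨c, by ring⟩
    rw [if_neg h1, if_pos h2]
    simp
  · rw [if_neg htop, sub_zero]
    refine if_congr ⟨?_, ?_⟩ rfl rfl
    · rintro ⟨r, hr0, _, h, h'⟩
      refine ⟨?_, hdvd.mpr ⟨r, h, h'⟩⟩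
      intro h0
      have hpos : 0 < r * ((Q : ℤ) - 1) := mul_pos hr0 (by omega)
      have hDz : D * (i + Q * j) = 0 := by omega
      have hμν : μ + Q * ν = 0 := by omega
      have h3 : i + Q * j = 0 := by simpa [hD0] using hDz
      have hjz : j = 0 := by
        have : Q * j = 0 := by omega
        rcases Nat.mul_eq_zero.mp this with h | h <;> omega
      have hνz : ν = 0 := by
        have : Q * ν = 0 := by omega
        rcases Nat.mul_eq_zero.mp this with h | h <;> omega
      have : i = 0 := by omega
      have : μ = 0 := by omega
      omega
    · rintro ⟨h0, h⟩
      obtain ⟨r, hr, hr'⟩ := hdvd.mp h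
      refine ⟨r, ?_, ?_, hr, hr'⟩
      · by_contra hneg
        have h4 : r * ((Q : ℤ) - 1) ≤ 0 := mul_nonpos_of_nonpos_of_nonneg (by omega) (by omega)
        have h5 : i = 0 := by omega
        have h6 : j = 0 := by omega
        have h7 : μ = 0 := by omega
        have h8 : ν = 0 := by omega
        subst_vars
        simp at h0
      · by_contra hneg
        have h4 : (2 * c) * ((Q : ℤ) - 1) ≤ r * ((Q : ℤ) - 1) :=
          mul_le_mul_of_nonneg_right (by omega) (by omega)
        have h5 : (2 * c) * ((Q : ℤ) - 1) = 4 * A + 2 * ε := by linear_combination -2 * hcast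
        apply htop
        omega

end Planar

section Slice

variable {K : Type*} [Field K]

/-- Power sums over the fixed subfield of `x ↦ x ^ Q` vanish below `Q - 1`. -/
theorem sum_fixed_pow_eq_zero [Fintype K] [DecidableEq K] {Q : ℕ} (hcard : Fintype.card K = Q ^ 2) (hQ : 1 < Q)
    {A : ℕ} (hA : 0 < A) (hAQ : A < Q - 1) :
    ∑ x : K with x ^ Q = x, x ^ A = 0 := by
  obtain ⟨g, hg⟩ := IsCyclic.exists_generator (α := Kˣ)
  have hord : orderOf g = Q ^ 2 - 1 := by
    rw [orderOf_eq_card_of_forall_mem_zpowers hg, Nat.card_units, Nat.card_eq_fintype_card, hcard]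
  have hq : Q ^ 2 - 1 = (Q + 1) * (Q - 1) := by
    zify [hQ.le, Nat.one_le_pow 2 Q (by omega)]; ring
  have hgq : (g : K) ^ (Q ^ 2) = g := by rw [← hcard]; exact FiniteField.pow_card _
  set c : K := (g : K) ^ (Q + 1) with hc
  have hc0 : c ≠ 0 := pow_ne_zero _ g.ne_zero
  have hcQ : c ^ Q = c := by
    rw [hc, ← pow_mul, show (Q + 1) * Q = Q ^ 2 + Q by ring, pow_add, hgq, pow_succ, mul_comm]
  have hcA : c ^ A ≠ 1 := by
    intro h
    have h1 : g ^ ((Q + 1) * A) = 1 := by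
      apply Units.ext
      rw [Units.val_pow_eq_pow_val, pow_mul]
      exact h
    have h2 := orderOf_dvd_of_pow_eq_one h1
    rw [hord, hq] at h2
    have h3 := Nat.dvd_of_mul_dvd_mul_left (by omega) h2
    exact absurd (Nat.le_of_dvd hA h3) (by omega)
  have hinv : ∑ x : K with x ^ Q = x, (c * x) ^ A = ∑ x : K with x ^ Q = x, x ^ A := by
    refine Finset.sum_bij (fun x _ => c * x) ?_ ?_ ?_ (fun _ _ => rfl)
    · intro x hx
      simp only [mem_filter, mem_univ, true_and] at hx ⊢
      rw [mul_pow, hcQ, hx]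
    · intro x _ y _ h
      exact mul_left_cancel₀ hc0 h
    · intro y hy
      simp only [mem_filter, mem_univ, true_and] at hy
      refine ⟨c⁻¹ * y, ?_, by field_simp⟩
      simp only [mem_filter, mem_univ, true_and]
      rw [mul_pow, inv_pow, hcQ, hy]
  simp only [mul_pow, ← Finset.mul_sum] at hinv
  have : (c ^ A - 1) * ∑ x : K with x ^ Q = x, x ^ A = 0 := by
    rw [sub_mul, hinv]; ring
  exact (mul_eq_zero.mp this).resolve_left (sub_ne_zero.mpr hcA)

theorem planar_slice_injOn {p Q m : ℕ} [Finite K] [Fact p.Prime] [CharP K p] (hQp : Q = p ^ m)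
    {D : ℕ} (hpl : IsPlanarFunction fun x : K => x ^ D) {y₀ : K} (hy₀ : y₀ ^ Q ≠ y₀) {x y : K} (hx : x ^ Q = x)
    (hy : y ^ Q = y)
    (h : (y₀ + x) ^ D - (y₀ + x) ^ (D * Q) = (y₀ + y) ^ D - (y₀ + y) ^ (D * Q)) : x = y := by
  by_contra hne
  have hsubQ : ∀ a b : K, (a - b) ^ Q = a ^ Q - b ^ Q := fun a b => by
    rw [hQp, sub_pow_char_pow]
  have haddQ : ∀ a b : K, (a + b) ^ Q = a ^ Q + b ^ Q := fun a b => by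
    rw [hQp, add_pow_char_pow]
  have hpowQ : ∀ a : K, a ^ Q = a → (a ^ D) ^ Q = a ^ D := fun a ha => by
    rw [← pow_mul, mul_comm, pow_mul, ha]
  set l := x - y with hl
  have hl0 : l ≠ 0 := sub_ne_zero.mpr hne
  have hlQ : l ^ Q = l := by rw [hl, hsubQ, hx, hy]
  let g : K → K := fun z => (z + l) ^ D - z ^ D - l ^ D
  have hg := hpl l hl0
  let F : Set K := {z | z ^ Q = z}
  have hmap : Set.MapsTo g F F := by
    intro z hz
    have hz' : z ^ Q = z := hz
    change g z ^ Q = g z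
    simp only [g]
    rw [hsubQ, hsubQ, hpowQ _ hlQ, hpowQ _ hz', hpowQ]
    rw [haddQ, hz', hlQ]
  have hsurj : Set.SurjOn g F F :=
    ((Set.toFinite F).injOn_iff_bijOn_of_mapsTo hmap |>.mp hg.1.injOn).surjOn
  have hw : g (y₀ + y) ∈ F := by
    change g (y₀ + y) ^ Q = g (y₀ + y)
    have e1 : g (y₀ + y) = (y₀ + x) ^ D - (y₀ + y) ^ D - l ^ D := by
      simp only [g, hl]
      congr 3
      ring
    rw [e1, hsubQ, hsubQ, hpowQ _ hlQ, ← pow_mul, ← pow_mul]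
    linear_combination -h
  obtain ⟨z, hz, hzg⟩ := hsurj hw
  have hz' : z = y₀ + y := hg.1 hzg
  apply hy₀
  have h3 : (y₀ + y) ^ Q = y₀ + y := hz' ▸ hz
  rw [haddQ, hy] at h3
  exact add_right_cancel h3

theorem planar_slice_sum_eq_zero [Fintype K] {p Q m : ℕ} [Fact p.Prime] [CharP K p] (hQp : Q = p ^ m)
    (hcard : Fintype.card K = Q ^ 2) (hQ : 1 < Q)
    {D A ε : ℕ} (hpl : IsPlanarFunction fun x : K => x ^ D)
    (hA : 0 < A) (hAQ : A < Q - 1) (hε : 0 < ε) :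
    ∑ y : K, (y ^ D - y ^ (D * Q)) ^ A * (y - y ^ Q) ^ ε = 0 := by
  classical
  have hsubQ : ∀ a b : K, (a - b) ^ Q = a ^ Q - b ^ Q := fun a b => by
    rw [hQp, sub_pow_char_pow]
  have haddQ : ∀ a b : K, (a + b) ^ Q = a ^ Q + b ^ Q := fun a b => by
    rw [hQp, add_pow_char_pow]
  have hQQ : ∀ a : K, (a ^ Q) ^ Q = a := fun a => by
    rw [← pow_mul, ← sq, ← hcard]; exact FiniteField.pow_card _
  rw [← Finset.sum_fiberwise univ (fun y : K => y - y ^ Q)]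
  refine Finset.sum_eq_zero fun δ _ => ?_
  have h1 : ∑ y : K with y - y ^ Q = δ, (y ^ D - y ^ (D * Q)) ^ A * (y - y ^ Q) ^ ε =
      (∑ y : K with y - y ^ Q = δ, (y ^ D - y ^ (D * Q)) ^ A) * δ ^ ε := by
    rw [Finset.sum_mul]
    refine Finset.sum_congr rfl fun y hy => ?_
    rw [(mem_filter.mp hy).2]
  rw [h1]
  by_cases hδ : δ = 0
  · rw [hδ, zero_pow hε.ne', mul_zero]
  by_cases hne : ∃ y₀ : K, y₀ - y₀ ^ Q = δ
  swap
  · rw [Finset.sum_eq_zero, zero_mul]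
    intro y hy
    exact absurd ⟨y, (mem_filter.mp hy).2⟩ hne
  obtain ⟨y₀, hy₀⟩ := hne
  have hδQ : δ ^ Q = -δ := by rw [← hy₀, hsubQ, hQQ]; ring
  have h2 : ∑ y : K with y - y ^ Q = δ, (y ^ D - y ^ (D * Q)) ^ A =
      ∑ x : K with x ^ Q = x, ((y₀ + x) ^ D - (y₀ + x) ^ (D * Q)) ^ A := by
    symm
    refine Finset.sum_bij (fun x _ => y₀ + x) ?_ ?_ ?_ (fun _ _ => rfl)
    · intro x hx
      simp only [mem_filter, mem_univ, true_and] at hx ⊢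
      rw [haddQ, hx, ← hy₀]; ring
    · intro x _ y _ h
      exact add_left_cancel h
    · intro y hy
      simp only [mem_filter, mem_univ, true_and] at hy
      refine ⟨y - y₀, ?_, by ring⟩
      simp only [mem_filter, mem_univ, true_and]
      rw [hsubQ]
      linear_combination hy₀ - hy
  let G : K → K := fun x => ((y₀ + x) ^ D - (y₀ + x) ^ (D * Q)) / δ
  have hmap : Set.MapsTo G {x | x ^ Q = x} {x | x ^ Q = x} := by
    intro x _
    change (G x) ^ Q = G x
    simp only [G]
    rw [div_pow, hsubQ, hδQ, pow_mul, hQQ]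
    field_simp
    ring
  have hinj : Set.InjOn G {x | x ^ Q = x} := by
    intro x hx y hy hxy
    refine planar_slice_injOn hQp hpl (y₀ := y₀) ?_ hx hy ?_
    · intro h
      apply hδ
      rw [← hy₀, h, sub_self]
    · exact (div_left_inj' hδ).mp hxy
  have hsurj : Set.SurjOn G {x | x ^ Q = x} {x | x ^ Q = x} :=
    ((Set.toFinite _).injOn_iff_bijOn_of_mapsTo hmap |>.mp hinj).surjOn
  have h3 : ∑ x : K with x ^ Q = x, G x ^ A = ∑ x : K with x ^ Q = x, x ^ A := by
    refine Finset.sum_bij (fun x _ => G x) ?_ ?_ ?_ (fun _ _ => rfl)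
    · intro x hx
      simp only [mem_filter, mem_univ, true_and] at hx ⊢
      exact hmap hx
    · intro x hx y hy h
      simp only [mem_filter, mem_univ, true_and] at hx hy
      exact hinj hx hy h
    · intro y hy
      simp only [mem_filter, mem_univ, true_and] at hy
      obtain ⟨x, hx, hxy⟩ := hsurj hy
      refine ⟨x, ?_, hxy⟩
      simpa using hx
  have h4 : ∑ x : K with x ^ Q = x, ((y₀ + x) ^ D - (y₀ + x) ^ (D * Q)) ^ A =
      (∑ x : K with x ^ Q = x, G x ^ A) * δ ^ A := by
    rw [Finset.sum_mul]
    refine Finset.sum_congr rfl fun x _ => ?_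
    rw [← mul_pow, div_mul_cancel₀ _ hδ]
  rw [h2, h4, h3, sum_fixed_pow_eq_zero hcard hQ hA hAQ, zero_mul, zero_mul]

open Classical in
theorem planar_slice_binomial_sum_eq_zero (K : Type*) [Field K] [Fintype K] {p Q m : ℕ} [Fact p.Prime] [CharP K p]
    (hQp : Q = p ^ m) (hcard : Fintype.card K = Q ^ 2) (hQ : 1 < Q)
    {D A ε : ℕ} {b : ℤ} (hD : (Q : ℤ) ^ 2 - 1 ∣ D - (1 + Q) + b * (Q - 1))
    (hpl : IsPlanarFunction fun x : K => x ^ D)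
    (hA : 0 < A) (hAQ : A < Q - 1) (hε : 0 < ε) (hc : 2 * A + ε = Q - 1) :
    ∑ μ ∈ range (ε + 1), ∑ i ∈ range (A + 1),
      (if 2 * ((Q : ℤ) + 1) ∣ (Q + 1) + (ε - 2 * μ) - 2 * b * (2 * i - A) then
        ((-1) ^ (i + μ) * A.choose i * ε.choose μ : ZMod p)
      else 0) = 0 := by
  apply ZMod.castHom_injective K
  simp only [map_sum, apply_ite (ZMod.castHom (dvd_refl p) K), map_mul, map_pow, map_neg, map_one,
    map_natCast, map_zero]
  have hmain := planar_slice_sum_eq_zero hQp hcard hQ hpl hA hAQ hε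
  have hexp : ∀ y : K, (y ^ D - y ^ (D * Q)) ^ A * (y - y ^ Q) ^ ε =
      ∑ μ ∈ range (ε + 1), ∑ i ∈ range (A + 1),
        ((-1) ^ (A + ε) * ((-1) ^ (i + μ) * A.choose i * ε.choose μ) : K) *
          y ^ (D * (i + Q * (A - i)) + (μ + Q * (ε - μ))) := by
    intro y
    rw [sub_pow, sub_pow, mul_comm, Finset.sum_mul_sum]
    refine Finset.sum_congr rfl fun μ _ => Finset.sum_congr rfl fun i _ => ?_
    rw [← pow_mul, ← pow_mul, ← pow_mul, show D * (i + Q * (A - i)) + (μ + Q * (ε - μ)) =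
      D * i + D * Q * (A - i) + μ + Q * (ε - μ) by ring]
    simp only [pow_add]
    ring
  rw [Finset.sum_congr rfl fun w _ => hexp w, Finset.sum_comm] at hmain
  have hswap : ∀ μ i : ℕ, μ ≤ ε → i ≤ A → ∑ y : K,
      ((-1) ^ (A + ε) * ((-1) ^ (i + μ) * A.choose i * ε.choose μ) : K) *
          y ^ (D * (i + Q * (A - i)) + (μ + Q * (ε - μ))) =
      -(-1) ^ (A + ε) * (if 2 * ((Q : ℤ) + 1) ∣ (Q + 1) + (ε - 2 * μ) - 2 * b * (2 * i - A) then
        ((-1) ^ (i + μ) * A.choose i * ε.choose μ : K) else 0) := by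
    intro μ i hμ hi
    rw [← Finset.mul_sum]
    have h0 : D * (i + Q * (A - i)) + (μ + Q * (ε - μ)) ≠ 0 := by
      intro h
      have h1 : μ = 0 := by omega
      have h2 : Q * (ε - μ) = 0 := by omega
      rcases Nat.mul_eq_zero.mp h2 with h | h <;> omega
    have hcast : (2 * A + ε : ℤ) = Q - 1 := by omega
    have hQ' : (1 : ℤ) < Q := by exact_mod_cast hQ
    have hdvd : Q ^ 2 - 1 ∣ D * (i + Q * (A - i)) + (μ + Q * (ε - μ)) ↔
        2 * ((Q : ℤ) + 1) ∣ (Q + 1) + (ε - 2 * μ) - 2 * b * (2 * i - A) := by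
      have h3 := dvd_exponent_iff hQ' hD (i : ℤ) (A - i) μ (ε - μ)
      rw [← Int.natCast_dvd_natCast]
      push_cast [Nat.cast_sub (Nat.one_le_pow 2 Q (by omega)), Nat.cast_sub hμ, Nat.cast_sub hi]
      rw [← add_assoc, h3]
      have e1 : ((Q : ℤ) + 1) + (ε - 2 * μ) - 2 * b * (2 * i - A) =
        1 * (Q + 1) + (ε - μ - μ) - 2 * b * (i - (A - i)) := by ring
      rw [e1]
      constructor
      · rintro ⟨r, hr, h⟩
        have hr1 : r = 1 := by
          have : r * ((Q : ℤ) - 1) = 1 * (Q - 1) := by linear_combination hcast - hr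
          exact mul_right_cancel₀ (by omega) this
        rwa [hr1] at h
      · intro h
        exact ⟨1, by linear_combination hcast, h⟩
    rw [sum_pow_eq_ite h0, hcard]
    by_cases h1 : Q ^ 2 - 1 ∣ D * (i + Q * (A - i)) + (μ + Q * (ε - μ))
    · rw [if_pos h1, if_pos (hdvd.mp h1)]; ring
    · rw [if_neg h1, if_neg (mt hdvd.mpr h1)]; ring
  have h5 : -(-1 : K) ^ (A + ε) ≠ 0 := neg_ne_zero.mpr (pow_ne_zero _ (neg_ne_zero.mpr one_ne_zero))
  apply mul_left_cancel₀ h5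
  rw [mul_zero]
  refine Eq.trans ?_ hmain
  rw [Finset.mul_sum]
  refine Finset.sum_congr rfl fun μ hμ => ?_
  rw [Finset.sum_comm (s := univ), Finset.mul_sum]
  refine Finset.sum_congr rfl fun i hi => ?_
  exact (hswap μ i (mem_range_succ_iff.mp hμ) (mem_range_succ_iff.mp hi)).symm

end Slice

section Sums

/-- The inner sum attached to a pair `(μ, ν)` in the two-dimensional power sum identity. -/
def pairSum (p Q : ℕ) (b : ℤ) (A μ ν : ℕ) : ZMod p :=
  ∑ i ∈ range (A + 1), ∑ j ∈ range (A + 1),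
    if 2 * (i + j) + μ + ν + 1 = Q ∧
        2 * ((Q : ℤ) + 1) ∣ (Q + 1) + (ν - μ) - 2 * b * (i - j) then
      (-1) ^ (i + j) * A.choose i * A.choose j else 0

/-- The inner sum attached to `μ` in the one-dimensional power sum identity. -/
def sliceSum (p Q : ℕ) (b : ℤ) (A ε μ : ℕ) : ZMod p :=
  ∑ i ∈ range (A + 1),
    if 2 * ((Q : ℤ) + 1) ∣ (Q + 1) + (ε - 2 * μ) - 2 * b * (2 * i - A) then
      (-1) ^ i * A.choose i else 0

/-- The power sum identities satisfied by a planar monomial. -/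
structure PlanarIdentities (p Q : ℕ) (b : ℤ) : Prop where
  pair : ∀ A ε : ℕ, 0 < A → 0 < ε → 2 * A + ε + 1 = Q →
    ∑ μ ∈ range (ε + 1), (ε.choose μ : ZMod p) *
      ∑ ν ∈ range (ε + 1), (ε.choose ν : ZMod p) * pairSum p Q b A μ ν = 0
  slice : ∀ A ε : ℕ, 0 < A → 0 < ε → 2 * A + ε + 1 = Q →
    ∑ μ ∈ range (ε + 1), (ε.choose μ : ZMod p) * ((-1) ^ μ * sliceSum p Q b A ε μ) = 0
  coprime : ∀ h : ℤ, (Q : ℤ) + 1 = 2 * h → IsCoprime b h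

theorem planar_coprime (K : Type*) [Field K] [Fintype K] {Q : ℕ}
    (hcard : Fintype.card K = Q ^ 2) (hQ : 1 < Q)
    {D : ℕ} {b : ℤ} (hD : (Q : ℤ) ^ 2 - 1 ∣ D - (1 + Q) + b * (Q - 1))
    (hpl : IsPlanarFunction fun x : K => x ^ D) {h : ℤ} (hh : (Q : ℤ) + 1 = 2 * h) : IsCoprime b h := by
  rw [Int.isCoprime_iff_gcd_eq_one]
  by_contra hne
  set l := Int.gcd b h with hl
  have hlh : (l : ℤ) ∣ h := Int.gcd_dvd_right ..
  have hlb : (l : ℤ) ∣ b := Int.gcd_dvd_left ..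
  have hl0 : l ≠ 0 := by
    intro h0
    rw [h0] at hlh
    have : h = 0 := by simpa using hlh
    omega
  have h2lQ : ((2 * l : ℕ) : ℤ) ∣ (Q : ℤ) + 1 := by
    rw [hh]; push_cast; exact mul_dvd_mul_left 2 hlh
  have h2lq : ((2 * l : ℕ) : ℤ) ∣ (Q : ℤ) ^ 2 - 1 :=
    h2lQ.trans (Dvd.intro ((Q : ℤ) - 1) (by ring))
  have h2lb : ((2 * l : ℕ) : ℤ) ∣ b * (Q - 1) := by
    push_cast
    rw [mul_comm (2 : ℤ)]
    exact mul_dvd_mul hlb ⟨h - 1, by linarith⟩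
  have h2lD : ((2 * l : ℕ) : ℤ) ∣ D := by
    have : (D : ℤ) = (D - (1 + Q) + b * (Q - 1)) + ((Q : ℤ) + 1) - b * (Q - 1) := by ring
    rw [this]
    exact dvd_sub (dvd_add (h2lq.trans hD) h2lQ) h2lb
  have hDn : 2 * l ∣ D := by exact_mod_cast h2lD
  have hqn : 2 * l ∣ Q ^ 2 - 1 := by
    zify [Nat.one_le_pow 2 Q (by omega)]
    exact_mod_cast h2lq
  obtain ⟨g, hg⟩ := IsCyclic.exists_generator (α := Kˣ)
  have hord : orderOf g = Q ^ 2 - 1 := by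
    rw [orderOf_eq_card_of_forall_mem_zpowers hg, Nat.card_units, Nat.card_eq_fintype_card, hcard]
  have hq0 : Q ^ 2 - 1 ≠ 0 := by
    have : 1 < Q ^ 2 := Nat.one_lt_pow two_ne_zero hQ
    omega
  obtain ⟨k, hk⟩ := hqn
  have hk0 : k ≠ 0 := by rintro rfl; exact hq0 (by simpa using hk)
  have hordv : orderOf (g ^ k) = 2 * l := by
    rw [orderOf_pow_of_dvd hk0 (by rw [hord, hk]; exact dvd_mul_left _ _), hord, hk]
    exact Nat.mul_div_cancel _ (Nat.pos_of_ne_zero hk0)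
  have hv2 : (g ^ k) ^ 2 ≠ 1 := by
    intro h
    have := Nat.le_of_dvd two_pos (orderOf_dvd_of_pow_eq_one h)
    omega
  have hv2' : ((g ^ k : Kˣ) : K) ^ 2 ≠ 1 := by
    intro h
    apply hv2
    apply Units.ext
    rw [Units.val_pow_eq_pow_val]
    exact h
  refine not_planar_of_pow_eq_one (K := K) (D := D) (v := ((g ^ k : Kˣ) : K)) ?_ ?_ ?_ ?_ hpl
  · exact even_iff_two_dvd.mpr ((dvd_mul_right 2 l).trans hDn)
  · rw [← Units.val_pow_eq_pow_val, orderOf_dvd_iff_pow_eq_one.mp (hordv ▸ hDn), Units.val_one]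
  · intro h; exact hv2' (by rw [h, one_pow])
  · intro h; exact hv2' (by rw [h]; ring)

theorem planarIdentities_of_planar (K : Type*) [Field K] [Fintype K] {p Q m : ℕ} [Fact p.Prime] [CharP K p]
    (hp2 : p ≠ 2) (hQp : Q = p ^ m) (hcard : Fintype.card K = Q ^ 2) (hQ : 1 < Q)
    {D : ℕ} {b : ℤ} (hD : (Q : ℤ) ^ 2 - 1 ∣ D - (1 + Q) + b * (Q - 1)) (hD0 : D ≠ 0)
    (hpl : IsPlanarFunction fun x : K => x ^ D) : PlanarIdentities p Q b where
  pair A ε hA hε hAε := by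
    classical
    rw [← planar_sum_eq_zero K hQp hcard hQ hD hD0 hpl (A := A) (ε := ε) (c := 1) (by omega) hε (by omega)]
    have hQodd : Odd Q := hQp ▸ ((Fact.out (p := p.Prime)).odd_of_ne_two hp2).pow
    simp only [Finset.mul_sum, pairSum]
    refine Finset.sum_congr rfl fun μ _ => Finset.sum_congr rfl fun ν _ => Finset.sum_congr rfl fun i _ =>
      Finset.sum_congr rfl fun j _ => ?_
    rw [mul_ite, mul_zero, mul_ite, mul_zero]
    by_cases hcond : 2 * (i + j) + μ + ν + 1 = Q ∧
        2 * ((Q : ℤ) + 1) ∣ (Q + 1) + (ν - μ) - 2 * b * (i - j)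
    · rw [if_pos hcond, if_pos ⟨1, by norm_num, by norm_num, by omega, by simpa using hcond.2⟩]
      have : (-1 : ZMod p) ^ (i + j + μ + ν) = (-1) ^ (i + j) := by
        rw [add_assoc, pow_add]
        have : Even (μ + ν) := by
          obtain ⟨k, hk⟩ := hQodd
          rw [Nat.even_iff]
          omega
        rw [this.neg_one_pow, mul_one]
      rw [this]; ring
    · rw [if_neg hcond, if_neg]
      rintro ⟨r, hr0, hr2, h1, h2⟩
      have : r = 1 := by push_cast at hr2; omega
      subst this
      exact hcond ⟨by omega, by simpa using h2⟩
  slice A ε hA hε hAε := by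
    classical
    rw [← planar_slice_binomial_sum_eq_zero K hQp hcard hQ hD hpl (A := A) (ε := ε) hA (by omega) hε (by omega)]
    simp only [Finset.mul_sum, sliceSum]
    refine Finset.sum_congr rfl fun μ _ => Finset.sum_congr rfl fun i _ => ?_
    rw [mul_ite, mul_zero, mul_ite, mul_zero]
    refine if_congr Iff.rfl ?_ rfl
    rw [pow_add]; ring
  coprime h hh := planar_coprime K hcard hQ hD hpl hh

theorem pairSum_swap (p Q : ℕ) (b : ℤ) (A μ ν : ℕ) : pairSum p Q b A μ ν = pairSum p Q b A ν μ := by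
  unfold pairSum
  rw [Finset.sum_comm]
  refine Finset.sum_congr rfl fun i _ => Finset.sum_congr rfl fun j _ => ?_
  refine if_congr (and_congr ⟨fun h => by omega, fun h => by omega⟩ ?_) (by rw [add_comm]; ring) rfl
  have : ((Q : ℤ) + 1) + (ν - μ) - 2 * b * (j - i) =
    2 * ((Q : ℤ) + 1) - ((Q + 1) + (μ - ν) - 2 * b * (i - j)) := by ring
  rw [this]
  exact dvd_sub_right (dvd_refl _)

theorem pairSum_reflect {p Q : ℕ} {b : ℤ} {A ε μ ν μ' ν' : ℕ} (hA : 2 * A + ε + 1 = Q)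
    (hμ : μ + μ' = ε) (hν : ν + ν' = ε) : pairSum p Q b A μ' ν' = pairSum p Q b A μ ν := by
  unfold pairSum
  rw [← Finset.sum_range_reflect]
  refine Finset.sum_congr rfl fun i hi => ?_
  rw [← Finset.sum_range_reflect]
  refine Finset.sum_congr rfl fun j hj => ?_
  have hi' := mem_range_succ_iff.mp hi
  have hj' := mem_range_succ_iff.mp hj
  simp only [Nat.add_sub_cancel]
  rw [Nat.choose_symm hi', Nat.choose_symm hj']
  refine if_congr (and_congr ⟨fun h => by omega, fun h => by omega⟩ ?_) ?_ rfl
  · push_cast [Nat.cast_sub hi', Nat.cast_sub hj']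
    have : ((Q : ℤ) + 1) + (ν' - μ') - 2 * b * (A - i - (A - j)) =
      2 * ((Q : ℤ) + 1) - ((Q + 1) + (ν - μ) - 2 * b * (i - j)) := by
      have h1 : (μ : ℤ) + μ' = ε := by exact_mod_cast hμ
      have h2 : (ν : ℤ) + ν' = ε := by exact_mod_cast hν
      linear_combination h2 - h1
    rw [this]
    exact dvd_sub_right (dvd_refl _)
  · congr 2
    have : A - i + (A - j) + (i + j) = 2 * A := by omega
    have h2 : (-1 : ZMod p) ^ (A - i + (A - j)) * (-1) ^ (i + j) = 1 := by
      rw [← pow_add, this, pow_mul]; simp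
    have h3 : (-1 : ZMod p) ^ (i + j) * (-1) ^ (i + j) = 1 := by
      rw [← mul_pow]; simp
    calc _ = (-1 : ZMod p) ^ (A - i + (A - j)) * ((-1) ^ (i + j) * (-1) ^ (i + j)) := by rw [h3, mul_one]
      _ = _ := by rw [← mul_assoc, h2, one_mul]

theorem pairSum_eq_zero {p Q : ℕ} {b : ℤ} {A μ ν : ℕ}
    (h : ∀ i j : ℕ, i ≤ A → j ≤ A → 2 * (i + j) + μ + ν + 1 = Q →
      2 * ((Q : ℤ) + 1) ∣ (Q + 1) + (ν - μ) - 2 * b * (i - j) →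
      (A.choose i : ZMod p) * A.choose j = 0) : pairSum p Q b A μ ν = 0 := by
  refine Finset.sum_eq_zero fun i hi => Finset.sum_eq_zero fun j hj => ?_
  split_ifs with hc
  · rw [mul_assoc, h i j (mem_range_succ_iff.mp hi) (mem_range_succ_iff.mp hj) hc.1 hc.2, mul_zero]
  · rfl

theorem eq_of_dvd_of_coprime {b h i i' A : ℤ} (hbh : IsCoprime b h) (hAh : A < h) (hi : 0 ≤ i) (hi' : 0 ≤ i')
    (hiA : i ≤ A) (hiA' : i' ≤ A) (hd : h ∣ b * (i - i')) : i = i' := by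
  have h1 : h ∣ i - i' := hbh.symm.dvd_of_dvd_mul_left hd
  obtain ⟨k, hk⟩ := h1
  have h2 : k < 1 := by nlinarith
  have h3 : -1 < k := by nlinarith
  have : k = 0 := by omega
  subst this
  linarith

theorem pairSum_eq_single {p Q : ℕ} {b h : ℤ} {A μ ν : ℕ} (hh : (Q : ℤ) + 1 = 2 * h) (hbh : IsCoprime b h)
    (hAh : (A : ℤ) < h) {i j : ℕ} (hi : i ≤ A) (hj : j ≤ A) (hs : 2 * (i + j) + μ + ν + 1 = Q)
    (hd : 2 * ((Q : ℤ) + 1) ∣ (Q + 1) + (ν - μ) - 2 * b * (i - j)) :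
    pairSum p Q b A μ ν = (-1) ^ (i + j) * A.choose i * A.choose j := by
  have huniq : ∀ i' j' : ℕ, i' ≤ A → j' ≤ A → (2 * (i' + j') + μ + ν + 1 = Q ∧
        2 * ((Q : ℤ) + 1) ∣ (Q + 1) + (ν - μ) - 2 * b * (i' - j')) → i' = i ∧ j' = j := by
    rintro i' j' hi' hj' ⟨hs', hd'⟩
    have h1 := dvd_sub hd hd'
    have h2 : ((Q : ℤ) + 1) + (ν - μ) - 2 * b * (i - j) - ((Q + 1) + (ν - μ) - 2 * b * (i' - j')) =
        4 * (b * (i' - i)) := by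
      have h3 : (j' : ℤ) = i + j - i' := by omega
      rw [h3]; ring
    rw [h2, hh, ← mul_assoc, show (2 : ℤ) * 2 = 4 by norm_num] at h1
    have h4 := Int.dvd_of_mul_dvd_mul_left (by norm_num) h1
    have h5 := eq_of_dvd_of_coprime hbh hAh (by omega) (by omega) (by omega) (by omega) h4
    omega
  unfold pairSum
  rw [Finset.sum_eq_single i, Finset.sum_eq_single j, if_pos ⟨hs, hd⟩]
  · intro j' hj' hne
    rw [if_neg]
    intro hc
    exact hne (huniq i j' hi (mem_range_succ_iff.mp hj') hc).2
  · intro hn; exact absurd (mem_range_succ_iff.mpr hj) hn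
  · intro i' hi' hne
    refine Finset.sum_eq_zero fun j' hj' => ?_
    rw [if_neg]
    intro hc
    exact hne (huniq i' j' (mem_range_succ_iff.mp hi') (mem_range_succ_iff.mp hj') hc).1
  · intro hn; exact absurd (mem_range_succ_iff.mpr hi) hn

theorem sliceSum_unique {Q : ℕ} {b h : ℤ} {A ε μ : ℕ} (hh : (Q : ℤ) + 1 = 2 * h) (hbh : IsCoprime b h)
    (hAh : (A : ℤ) < h) {i i' : ℕ} (hi : i ≤ A) (hi' : i' ≤ A)
    (hd : 2 * ((Q : ℤ) + 1) ∣ (Q + 1) + (ε - 2 * μ) - 2 * b * (2 * i - A))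
    (hd' : 2 * ((Q : ℤ) + 1) ∣ (Q + 1) + (ε - 2 * μ) - 2 * b * (2 * i' - A)) : i' = i := by
  have h1 := dvd_sub hd hd'
  have h2 : ((Q : ℤ) + 1) + (ε - 2 * μ) - 2 * b * (2 * i - A) -
      ((Q + 1) + (ε - 2 * μ) - 2 * b * (2 * i' - A)) = 4 * (b * (i' - i)) := by ring
  rw [h2, hh, ← mul_assoc, show (2 : ℤ) * 2 = 4 by norm_num] at h1
  have h4 := Int.dvd_of_mul_dvd_mul_left (by norm_num) h1
  have h5 := eq_of_dvd_of_coprime hbh hAh (by omega) (by omega) (by omega) (by omega) h4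
  omega

theorem sliceSum_eq_single {p Q : ℕ} {b h : ℤ} {A ε μ : ℕ} (hh : (Q : ℤ) + 1 = 2 * h) (hbh : IsCoprime b h)
    (hAh : (A : ℤ) < h) {i : ℕ} (hi : i ≤ A)
    (hd : 2 * ((Q : ℤ) + 1) ∣ (Q + 1) + (ε - 2 * μ) - 2 * b * (2 * i - A)) :
    sliceSum p Q b A ε μ = (-1) ^ i * A.choose i := by
  unfold sliceSum
  rw [Finset.sum_eq_single i, if_pos hd]
  · intro i' hi' hne
    rw [if_neg]
    intro hd'
    exact hne (sliceSum_unique hh hbh hAh hi (mem_range_succ_iff.mp hi') hd hd')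
  · intro hn; exact absurd (mem_range_succ_iff.mpr hi) hn

theorem sliceSum_eq_zero {p Q : ℕ} {b : ℤ} {A ε μ : ℕ}
    (h : ∀ i : ℕ, i ≤ A → ¬ 2 * ((Q : ℤ) + 1) ∣ (Q + 1) + (ε - 2 * μ) - 2 * b * (2 * i - A)) :
    sliceSum p Q b A ε μ = 0 :=
  Finset.sum_eq_zero fun i hi => if_neg (h i (mem_range_succ_iff.mp hi))

theorem sliceSum_reflect {p Q : ℕ} {b : ℤ} {A ε μ μ' : ℕ} (hA : Even A) (hμ : μ + μ' = ε) :
    sliceSum p Q b A ε μ' = sliceSum p Q b A ε μ := by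
  unfold sliceSum
  rw [← Finset.sum_range_reflect]
  refine Finset.sum_congr rfl fun i hi => ?_
  have hi' := mem_range_succ_iff.mp hi
  simp only [Nat.add_sub_cancel]
  rw [Nat.choose_symm hi']
  refine if_congr ?_ ?_ rfl
  · push_cast [Nat.cast_sub hi']
    have : ((Q : ℤ) + 1) + (ε - 2 * μ') - 2 * b * (2 * (A - i) - A) =
      2 * ((Q : ℤ) + 1) - ((Q + 1) + (ε - 2 * μ) - 2 * b * (2 * i - A)) := by
      have h1 : (μ : ℤ) + μ' = ε := by exact_mod_cast hμ
      linear_combination -2 * h1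
    rw [this]
    exact dvd_sub_right (dvd_refl _)
  · congr 1
    rcases Nat.even_or_odd i with h | h
    · rw [h.neg_one_pow, ((Nat.even_sub hi').mpr (by tauto)).neg_one_pow]
    · rw [h.neg_one_pow, Odd.neg_one_pow]
      exact (Nat.odd_sub hi').mpr ⟨fun h' => absurd h' (by simpa using hA), fun h' => absurd h' (by simpa using h)⟩

theorem pairSum_complement {p Q : ℕ} {b h : ℤ} {A ε μ ν : ℕ} (hh : (Q : ℤ) + 1 = 2 * h) (hbh : IsCoprime b h)
    (hA : 2 * A + ε + 1 = Q) (hμ : μ + ν = ε) :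
    pairSum p Q b A μ ν = (-1) ^ A * sliceSum p Q b A ε μ ^ 2 := by
  have hAh : (A : ℤ) < h := by omega
  by_cases hex : ∃ i : ℕ, i ≤ A ∧ 2 * ((Q : ℤ) + 1) ∣ (Q + 1) + (ε - 2 * μ) - 2 * b * (2 * i - A)
  · obtain ⟨i, hi, hd⟩ := hex
    rw [sliceSum_eq_single hh hbh hAh hi hd,
      pairSum_eq_single hh hbh hAh hi (Nat.sub_le A i) (by omega) (j := A - i)]
    · rw [Nat.choose_symm hi, Nat.add_sub_cancel' hi, mul_pow, ← pow_mul, mul_comm i 2, pow_mul]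
      simp [sq, mul_assoc]
    · convert hd using 1
      push_cast [Nat.cast_sub hi]
      have : (μ : ℤ) + ν = ε := by exact_mod_cast hμ
      linear_combination this
  · push Not at hex
    rw [sliceSum_eq_zero hex, pairSum_eq_zero]
    · simp
    · intro i j hi hj hs hd
      refine absurd ?_ (hex i hi)
      convert hd using 1
      have h1 : (j : ℤ) = A - i := by omega
      have : (μ : ℤ) + ν = ε := by exact_mod_cast hμ
      rw [h1]
      linear_combination -this

open Polynomial in
/-- Binomial sums with a two-digit upper index split digitwise in characteristic `p`. -/
theorem sum_choose_digits {p : ℕ} [Fact p.Prime] (a l e₀ e₁ : ℕ) (F : ℕ → ZMod p) :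
    ∑ μ ∈ range (e₀ * p ^ a + e₁ * p ^ l + 1), ((e₀ * p ^ a + e₁ * p ^ l).choose μ : ZMod p) * F μ =
      ∑ μ₀ ∈ range (e₀ + 1), ∑ μ₁ ∈ range (e₁ + 1),
        (e₀.choose μ₀ : ZMod p) * e₁.choose μ₁ * F (μ₀ * p ^ a + μ₁ * p ^ l) := by
  let Φ : (ZMod p)[X] →ₗ[ZMod p] ZMod p := Polynomial.lsum fun n => F n • LinearMap.id
  have hΦ : ∀ (c n : ℕ), Φ ((c : (ZMod p)[X]) * X ^ n) = c * F n := by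
    intro c n
    have : ((c : (ZMod p)[X]) * X ^ n) = monomial n (c : ZMod p) := by
      rw [← C_mul_X_pow_eq_monomial]; simp
    rw [this]
    simp only [Φ, Polynomial.lsum_apply]
    rw [Polynomial.sum_monomial_index _ _ (by simp)]
    simp [mul_comm]
  have hpoly : ((X : (ZMod p)[X]) + 1) ^ (e₀ * p ^ a + e₁ * p ^ l) =
      (X ^ p ^ a + 1) ^ e₀ * (X ^ p ^ l + 1) ^ e₁ := by
    rw [pow_add, mul_comm e₀, mul_comm e₁, pow_mul, pow_mul, add_pow_char_pow, add_pow_char_pow]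
    simp
  have h1 := congrArg Φ hpoly
  rw [add_pow, add_pow, add_pow, Finset.sum_mul_sum, map_sum, map_sum] at h1
  simp only [one_pow, mul_one, map_sum] at h1
  calc _ = _ := Finset.sum_congr rfl fun μ _ => ((congrArg Φ (mul_comm _ _)).trans (hΦ _ _)).symm
    _ = _ := h1
    _ = _ := Finset.sum_congr rfl fun μ₀ _ => Finset.sum_congr rfl fun μ₁ _ => by
      rw [← Nat.cast_mul, ← hΦ]
      congr 1
      push_cast
      rw [pow_add, ← pow_mul, ← pow_mul, mul_comm (p ^ a), mul_comm (p ^ l)]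
      ring

end Sums

section Binomials

variable {p : ℕ} [hpf : Fact p.Prime]

theorem choose_mul_pow_add (a N x k y : ℕ) (hx : x < p ^ a) (hy : y < p ^ a) :
    (((p ^ a * N + x).choose (p ^ a * k + y) : ℕ) : ZMod p) = (N.choose k : ZMod p) * x.choose y := by
  have hp0 : 0 < p := hpf.out.pos
  induction a generalizing N x k y with
  | zero =>
    have : x = 0 := by simpa using hx
    have : y = 0 := by simpa using hy
    subst_vars
    simp
  | succ a ih =>
    have lucas : ∀ n k : ℕ, ((n.choose k : ℕ) : ZMod p) = ((n % p).choose (k % p) : ZMod p) * (n / p).choose (k / p) := by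
      intro n k
      have := (ZMod.natCast_eq_natCast_iff _ _ _).mpr (Choose.choose_modEq_choose_mod_mul_choose_div_nat (n := n) (k := k) (p := p))
      simpa using this
    have hmod : ∀ N x : ℕ, (p ^ (a + 1) * N + x) % p = x % p := by
      intro N x
      rw [pow_succ', mul_assoc, Nat.mul_add_mod]
    have hdiv : ∀ N x : ℕ, (p ^ (a + 1) * N + x) / p = p ^ a * N + x / p := by
      intro N x
      rw [pow_succ', mul_assoc, Nat.mul_add_div hp0]
    have hlt : ∀ x, x < p ^ (a + 1) → x / p < p ^ a := by
      intro x hx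
      rw [Nat.div_lt_iff_lt_mul hp0, ← pow_succ]
      exact hx
    rw [lucas, hmod, hmod, hdiv, hdiv, ih _ _ _ _ (hlt x hx) (hlt y hy), lucas x y]
    ring

theorem choose_pow_sub_one (a k : ℕ) (hk : k < p ^ a) :
    (((p ^ a - 1).choose k : ℕ) : ZMod p) = (-1) ^ k := by
  induction k with
  | zero => simp
  | succ k ih =>
    have hpos : 0 < p ^ a := pow_pos hpf.out.pos a
    have h1 : (p ^ a).choose (k + 1) = (p ^ a - 1).choose k + (p ^ a - 1).choose (k + 1) := by
      conv_lhs => rw [← Nat.sub_add_cancel hpos]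
      exact Nat.choose_succ_succ _ _
    have h2 : (((p ^ a).choose (k + 1) : ℕ) : ZMod p) = 0 :=
      (ZMod.natCast_eq_zero_iff _ _).mpr (hpf.out.dvd_choose_pow (by omega) (by omega))
    rw [h1, Nat.cast_add, ih (by omega)] at h2
    rw [pow_succ]
    linear_combination h2

theorem choose_ne_zero_of_lt {n k : ℕ} (hn : n < p) (hk : k ≤ n) : ((n.choose k : ℕ) : ZMod p) ≠ 0 := by
  rw [Ne, ZMod.natCast_eq_zero_iff]
  intro h
  have h1 : p ∣ n.factorial := by
    rw [← Nat.choose_mul_factorial_mul_factorial hk, mul_assoc]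
    exact h.mul_right _
  exact absurd (hpf.out.dvd_factorial.mp h1) (by omega)

theorem choose_mul_pow_sub_one (a N k y : ℕ) (hy : y < p ^ a) :
    (((p ^ a * N + (p ^ a - 1)).choose (p ^ a * k + y) : ℕ) : ZMod p) = (N.choose k : ZMod p) * (-1) ^ y := by
  rw [choose_mul_pow_add a N _ k y (by have := pow_pos hpf.out.pos a; omega) hy, choose_pow_sub_one a y hy]

theorem choose_mul_pow_sub_one_ne_zero {a N i : ℕ} (hN : N < p) (hi : i ≤ p ^ a * N + (p ^ a - 1)) :
    (((p ^ a * N + (p ^ a - 1)).choose i : ℕ) : ZMod p) ≠ 0 := by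
  have hpos : 0 < p ^ a := pow_pos hpf.out.pos a
  rw [← Nat.div_add_mod i (p ^ a), choose_mul_pow_sub_one _ _ _ _ (Nat.mod_lt _ hpos)]
  refine mul_ne_zero (choose_ne_zero_of_lt hN ?_) (pow_ne_zero _ (neg_ne_zero.mpr one_ne_zero))
  rw [← Nat.lt_succ_iff, Nat.div_lt_iff_lt_mul hpos, Nat.succ_mul, mul_comm]
  omega

/-- `C(p ^ l - 1 - τ, i)` and `C(i + τ, τ)` vanish modulo `p` simultaneously. -/
theorem choose_pow_sub_eq_zero_iff {l τ i : ℕ} (h : i + τ < p ^ l) :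
    (((p ^ l - 1 - τ).choose i : ℕ) : ZMod p) = 0 ↔ (((i + τ).choose τ : ℕ) : ZMod p) = 0 := by
  have h1 := Nat.choose_mul (n := p ^ l - 1) (k := i + τ) (s := τ) (by omega)
  rw [Nat.add_sub_cancel] at h1
  have h2 := congrArg (Nat.cast (R := ZMod p)) h1
  push_cast at h2
  rw [choose_pow_sub_one l _ h, choose_pow_sub_one l _ (by omega)] at h2
  have hne : ∀ k : ℕ, (-1 : ZMod p) ^ k ≠ 0 := fun k => pow_ne_zero _ (neg_ne_zero.mpr one_ne_zero)
  constructor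
  · intro h3
    rw [h3, mul_zero] at h2
    exact (mul_eq_zero.mp h2).resolve_left (hne _)
  · intro h3
    rw [h3, mul_zero] at h2
    exact (mul_eq_zero.mp h2.symm).resolve_left (hne _)

end Binomials

theorem PlanarIdentities.pair_digits {p Q : ℕ} [Fact p.Prime] {b : ℤ} (H : PlanarIdentities p Q b)
    {a l e₀ e₁ A : ℕ} (hA : 0 < A) (hε : 0 < e₀ * p ^ a + e₁ * p ^ l)
    (hAQ : 2 * A + (e₀ * p ^ a + e₁ * p ^ l) + 1 = Q) :
    ∑ μ₀ ∈ range (e₀ + 1), ∑ μ₁ ∈ range (e₁ + 1), (e₀.choose μ₀ : ZMod p) * e₁.choose μ₁ *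
      ∑ ν₀ ∈ range (e₀ + 1), ∑ ν₁ ∈ range (e₁ + 1), (e₀.choose ν₀ : ZMod p) * e₁.choose ν₁ *
        pairSum p Q b A (μ₀ * p ^ a + μ₁ * p ^ l) (ν₀ * p ^ a + ν₁ * p ^ l) = 0 := by
  have h := H.pair A _ hA hε hAQ
  rw [sum_choose_digits a l e₀ e₁] at h
  simpa only [sum_choose_digits a l e₀ e₁] using h

theorem PlanarIdentities.slice_digits {p Q : ℕ} [Fact p.Prime] {b : ℤ} (H : PlanarIdentities p Q b)
    {a l e₀ e₁ A : ℕ} (hA : 0 < A) (hε : 0 < e₀ * p ^ a + e₁ * p ^ l)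
    (hAQ : 2 * A + (e₀ * p ^ a + e₁ * p ^ l) + 1 = Q) :
    ∑ μ₀ ∈ range (e₀ + 1), ∑ μ₁ ∈ range (e₁ + 1), (e₀.choose μ₀ : ZMod p) * e₁.choose μ₁ *
      ((-1) ^ (μ₀ * p ^ a + μ₁ * p ^ l) *
        sliceSum p Q b A (e₀ * p ^ a + e₁ * p ^ l) (μ₀ * p ^ a + μ₁ * p ^ l)) = 0 := by
  have h := H.slice A _ hA hε hAQ
  rwa [sum_choose_digits a l e₀ e₁] at h

section OddIndex

variable {p Q P L γ b : ℤ}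

/-- The divisibility condition for an invertible `b`, solved for the indices. -/
theorem odd_index_eq (hQ : Q = p * L) (hb : Q + 1 ∣ b * (1 + 2 * p * γ) - 1) {i j μ ν x y : ℤ}
    (hX : ν - μ = x * P + y * L) (hs : 2 * (i + j) + μ + ν + 1 = Q)
    (hd : 2 * (Q + 1) ∣ (Q + 1) + (ν - μ) - 2 * b * (i - j)) :
    ∃ k : ℤ, 2 * i = Q - μ + γ * (p * P * x - y) - (Q + 1) * k ∧
      2 * j = (Q + 1) * k - 1 - ν - γ * (p * P * x - y) := by
  obtain ⟨t, ht⟩ := hb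
  obtain ⟨u, hu⟩ := hd
  subst hQ
  have key : p * L + 1 + (ν - μ) + 2 * (γ * (p * P * x - y)) - 2 * (i - j) =
      2 * (p * L + 1) * ((1 + 2 * p * γ) * u + t * (i - j) - p * γ - γ * y) := by
    linear_combination (1 + 2 * p * γ) * hu + 2 * (i - j) * ht - 2 * p * γ * hX
  refine ⟨(1 + 2 * p * γ) * u + t * (i - j) - p * γ - γ * y, ?_, ?_⟩ <;>
    apply mul_left_cancel₀ (two_ne_zero' ℤ)
  · linear_combination hs - key
  · linear_combination hs + key

theorem odd_index_dvd (hQ : Q = p * L) {h : ℤ} (hh : Q + 1 = 2 * h)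
    (hb : Q + 1 ∣ b * (1 + 2 * p * γ) - 1) {i j μ ν x y : ℤ}
    (hX : ν - μ = x * P + y * L) (hXe : 2 ∣ ν - μ) (k : ℤ)
    (hi : 2 * i = Q - μ + γ * (p * P * x - y) - (Q + 1) * k)
    (hj : 2 * j = (Q + 1) * k - 1 - ν - γ * (p * P * x - y)) :
    2 * (Q + 1) ∣ (Q + 1) + (ν - μ) - 2 * b * (i - j) := by
  obtain ⟨t, ht⟩ := hb
  obtain ⟨v, hv⟩ := hXe
  subst hQ
  refine ⟨p * γ * b - h * t - t * v + b * γ * y + b * k, ?_⟩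
  linear_combination (-b) * hi + b * hj - (p * L + 1) * ht - (p * L + 1) * t * hh  +
    (-(p * L + 1) * t) * hv
    + 2 * b * p * γ * hX - (ν - μ) * ht

theorem odd_of_odd_index (hQ : Q = p * L) {h : ℤ} (hh : Q + 1 = 2 * h)
    (hb : Q + 1 ∣ b * (1 + 2 * p * γ) - 1) {i j μ ν : ℤ} (hs : 2 * (i + j) + μ + ν + 1 = Q)
    (hd : 2 * (Q + 1) ∣ (Q + 1) + (ν - μ) - 2 * b * (i - j)) : μ % 2 = 1 := by
  obtain ⟨k, h1, -⟩ := odd_index_eq (P := ν - μ) (x := 1) (y := 0) hQ hb (by ring) hs hd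
  obtain ⟨v, hv⟩ : ∃ v, ν - μ = 2 * v := ⟨h - 1 - i - j - μ, by omega⟩
  rw [hv, hh] at h1
  have h2 : γ * (p * (2 * v) * 1 - 0) = 2 * (γ * p * v) := by ring
  have h3 : 2 * h * k = 2 * (h * k) := by ring
  rw [h2, h3] at h1
  omega

end OddIndex

theorem mul_trichotomy {N : ℤ} (hN : 0 < N) (k : ℤ) :
    N * k ≤ -N ∨ N * k = 0 ∨ N * k = N ∨ 2 * N ≤ N * k := by
  rcases lt_trichotomy k 0 with h | h | h
  · left; nlinarith
  · right; left; simp [h]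
  · rcases (show 1 ≤ k from h).eq_or_lt with h1 | h1
    · right; right; left; simp [← h1]
    · right; right; right; nlinarith

section OddCase

variable {p Q L γ : ℕ} {b h : ℤ}

theorem pairSum_eq_zero_of_even (hQ : Q = p * L) (hh : (Q : ℤ) + 1 = 2 * h)
    (hb : (Q : ℤ) + 1 ∣ b * (1 + 2 * p * γ) - 1) {A μ ν : ℕ} (hμ : μ % 2 = 0) : pairSum p Q b A μ ν = 0 := by
  refine pairSum_eq_zero fun i j _ _ hs hd => ?_
  have := odd_of_odd_index (p := p) (L := L) (by exact_mod_cast hQ) hh hb (i := i) (j := j) (μ := μ) (ν := ν)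
    (by exact_mod_cast hs) hd
  omega

theorem pairSum_eq_zero_of_even_right (hQ : Q = p * L) (hh : (Q : ℤ) + 1 = 2 * h)
    (hb : (Q : ℤ) + 1 ∣ b * (1 + 2 * p * γ) - 1) {A μ ν : ℕ} (hμ : ν % 2 = 0) : pairSum p Q b A μ ν = 0 := by
  rw [pairSum_swap]; exact pairSum_eq_zero_of_even hQ hh hb hμ

theorem sliceSum_eq_zero_of_even (hQ : Q = p * L) (hh : (Q : ℤ) + 1 = 2 * h)
    (hb : (Q : ℤ) + 1 ∣ b * (1 + 2 * p * γ) - 1) {A ε μ : ℕ} (hA : 2 * A + ε + 1 = Q)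
    (hμ : μ % 2 = 0) : sliceSum p Q b A ε μ = 0 := by
  refine sliceSum_eq_zero fun i _ hd => ?_
  have := odd_of_odd_index (p := p) (L := L) (by exact_mod_cast hQ) hh hb (i := i) (j := A - i) (μ := μ)
    (ν := ε - μ) (by omega) (by convert hd using 1; ring)
  omega

theorem pairSum_self_eq_zero (hQ : Q = p * L)
    (hb : (Q : ℤ) + 1 ∣ b * (1 + 2 * p * γ) - 1) {A μ : ℕ} : pairSum p Q b A μ μ = 0 := by
  refine pairSum_eq_zero fun i j _ _ hs hd => ?_
  obtain ⟨k, h1, h2⟩ := odd_index_eq (p := p) (L := L) (P := 0) (x := 0) (y := 0) (by exact_mod_cast hQ) hb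
    (i := i) (j := j) (μ := μ) (ν := μ) (by ring) (by exact_mod_cast hs) hd
  rcases mul_trichotomy (N := (Q : ℤ) + 1) (by omega) k with h | h | h | h <;> simp at h1 h2 <;> omega

theorem odd_size_step [Fact p.Prime] (hp5 : 5 < p) {l a : ℕ} (hQl : Q = p ^ (l + 1)) (H : PlanarIdentities p Q b)
    (hh : (Q : ℤ) + 1 = 2 * h)
    (hb : (Q : ℤ) + 1 ∣ b * (1 + 2 * p * γ) - 1) (hal : a < l) (hPγ : p ^ a ∣ γ)
    (hwrap : p ^ a + γ * (p * p ^ a + 1) ≤ Q) : γ * (p * p ^ a + 1) ≤ p ^ l := by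
  by_contra hcon
  have hpp : p.Prime := Fact.out
  have hpodd : Odd p := hpp.odd_of_ne_two (by omega)
  obtain ⟨α, hα⟩ := hpodd
  obtain ⟨P₁, hP₁⟩ : Odd (p ^ a) := (hpp.odd_of_ne_two (by omega)).pow
  obtain ⟨L₁, hL₁⟩ : Odd (p ^ (l - a)) := (hpp.odd_of_ne_two (by omega)).pow
  obtain ⟨γ₁, hγ₁⟩ := hPγ
  have hPL : p ^ l = p ^ a * p ^ (l - a) := by rw [← pow_add]; congr 1; omega
  have hQL : Q = p * p ^ l := by rw [hQl, pow_succ']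
  obtain ⟨L₂, hL₂⟩ : Odd (p ^ l) := (hpp.odd_of_ne_two (by omega)).pow
  have hPpos : 0 < p ^ a := by omega
  have hPltL : p ^ a < p ^ l := Nat.pow_lt_pow_right (by omega) hal
  have hα3 : 3 ≤ α := by omega
  have hQα : Q = 2 * (α * p ^ l) + p ^ l := by rw [hQL, hα]; ring
  have hαLe : 3 * p ^ l ≤ α * p ^ l := Nat.mul_le_mul_right _ hα3
  have hW : γ * (p * p ^ a + 1) = 2 * (γ * (α * p ^ a + P₁ + 1)) := by
    have : p * p ^ a = 2 * (α * p ^ a) + p ^ a := by rw [hα]; ring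
    rw [this, hP₁]; ring
  set W := γ * (α * p ^ a + P₁ + 1) with hWdef
  have hcast : (γ : ℤ) * (p * (p ^ a : ℕ) + 1) = 2 * W := by exact_mod_cast hW
  set P := p ^ a with hP
  set L := p ^ l with hL
  obtain ⟨A, hA⟩ : ∃ A, 2 * A + (1 * P + 1 * L) + 1 = Q := ⟨α * L - P₁ - 1, by omega⟩
  obtain ⟨i, hi⟩ : ∃ i, 2 * i + P + 2 * W = Q := ⟨(Q - P - 2 * W) / 2, by omega⟩
  obtain ⟨j, hj⟩ : ∃ j, 2 * j + 1 + L = 2 * W := ⟨(2 * W - 1 - L) / 2, by omega⟩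
  have hij : i + j = A := by omega
  have hne : (A.choose i : ZMod p) ≠ 0 := by
    have hAP : A = P * (α * p ^ (l - a) - 1) + P₁ := by
      have h1 : P * (α * p ^ (l - a) - 1) = α * L - P := by
        rw [Nat.mul_sub, mul_one, hPL]; congr 1; ring
      omega
    have hiP : ∃ i', i = P * i' := by
      refine ⟨α * p ^ (l - a) + L₁ - γ₁ * (α * P + P₁ + 1), ?_⟩
      have h1 : P * (α * p ^ (l - a) + L₁ - γ₁ * (α * P + P₁ + 1)) = α * L + P * L₁ - W := by
        rw [Nat.mul_sub, hWdef, hγ₁, hPL]; congr 1 <;> ring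
      have h2 : L = 2 * (P * L₁) + P := by rw [hPL, hL₁]; ring
      omega
    obtain ⟨i', hi'⟩ := hiP
    have hle : i' ≤ α * p ^ (l - a) - 1 := by
      by_contra hgt
      have : P * (α * p ^ (l - a) - 1 + 1) ≤ P * i' := Nat.mul_le_mul_left _ (by omega)
      rw [mul_add] at this
      omega
    have e1 : A.choose i = (P * (α * p ^ (l - a) - 1) + P₁).choose (P * i' + 0) := by
      rw [← hAP, hi', add_zero]
    rw [e1, choose_mul_pow_add a _ _ _ _ (by omega) hPpos]
    have e2 : α * p ^ (l - a) - 1 = p ^ (l - a) * (α - 1) + (p ^ (l - a) - 1) := by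
      obtain ⟨α', rfl⟩ : ∃ α', α = α' + 1 := ⟨α - 1, by omega⟩
      have : (α' + 1) * p ^ (l - a) = p ^ (l - a) * α' + p ^ (l - a) := by ring
      simp only [Nat.add_sub_cancel]
      omega
    rw [Nat.choose_zero_right, Nat.cast_one, mul_one, e2]
    exact choose_mul_pow_sub_one_ne_zero (by omega) (e2 ▸ hle)
  have hAh : (A : ℤ) < h := by omega
  have hval : pairSum p Q b A (1 * P + 0 * L) (0 * P + 1 * L) = (-1) ^ (i + j) * A.choose i * A.choose j := by
    refine pairSum_eq_single hh (H.coprime h hh) hAh (by omega) (by omega) (by omega) ?_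
    refine odd_index_dvd (p := p) (L := L) (P := P) (x := -1) (y := 1) (by exact_mod_cast hQL) hh hb
      (by push_cast; ring) (by push_cast; omega) 0 ?_ ?_
    · push_cast at hcast ⊢
      linarith
    · push_cast at hcast ⊢
      linarith
  have hsum := H.pair_digits (A := A) (a := a) (l := l) (e₀ := 1) (e₁ := 1) (by omega) (by omega) hA
  simp only [sum_range_succ, sum_range_zero, zero_add, ← hP, ← hL] at hsum
  have z1 : ∀ ν, pairSum p Q b A (0 * P + 0 * L) ν = 0 := fun ν => pairSum_eq_zero_of_even hQL hh hb (by omega)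
  have z2 : ∀ ν, pairSum p Q b A (1 * P + 1 * L) ν = 0 := fun ν => pairSum_eq_zero_of_even hQL hh hb (by omega)
  have z3 : ∀ ν, pairSum p Q b A ν (0 * P + 0 * L) = 0 :=
    fun ν => pairSum_eq_zero_of_even_right hQL hh hb (by omega)
  have z4 : ∀ ν, pairSum p Q b A ν (1 * P + 1 * L) = 0 :=
    fun ν => pairSum_eq_zero_of_even_right hQL hh hb (by omega)
  have z5 : ∀ μ, pairSum p Q b A μ μ = 0 := fun μ => pairSum_self_eq_zero hQL hb
  have z6 := pairSum_swap p Q b A (0 * P + 1 * L) (1 * P + 0 * L)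
  simp only [z1, z2, z3, z4, z5, z6, hval, mul_zero, add_zero, zero_add] at hsum
  simp only [Nat.choose_self, Nat.choose_zero_right, Nat.cast_one, one_mul] at hsum
  rw [← two_mul] at hsum
  have h2 : (2 : ZMod p) ≠ 0 := by
    have : ((2 : ℕ) : ZMod p) ≠ 0 := by
      rw [Ne, ZMod.natCast_eq_zero_iff]
      exact fun hd => absurd (Nat.le_of_dvd two_pos hd) (by omega)
    exact_mod_cast this
  have hCj : A.choose j = A.choose i := by
    rw [← hij, Nat.choose_symm_add]
  rw [hCj] at hsum
  exact mul_ne_zero h2 (mul_ne_zero (mul_ne_zero (pow_ne_zero _ (neg_ne_zero.mpr one_ne_zero)) hne) hne) hsum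

theorem odd_size_bound [Fact p.Prime] (hp5 : 5 < p) {l : ℕ} (hQl : Q = p ^ (l + 1)) (H : PlanarIdentities p Q b)
    (hh : (Q : ℤ) + 1 = 2 * h) (hγ : 0 < γ) (hγL : 2 * γ < p ^ l)
    (hb : (Q : ℤ) + 1 ∣ b * (1 + 2 * p * γ) - 1) (a : ℕ) (hPγ : p ^ a ∣ γ) : γ * (p * p ^ a + 1) ≤ p ^ l := by
  have hpp : p.Prime := Fact.out
  have hQL : Q = p * p ^ l := by rw [hQl, pow_succ']
  have hal : ∀ a, p ^ a ∣ γ → a < l := by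
    intro a ha
    have h1 := Nat.le_of_dvd hγ ha
    exact (Nat.pow_lt_pow_iff_right (by omega : 1 < p)).mp (by omega)
  induction a with
  | zero =>
    refine odd_size_step hp5 hQl H hh hb (hal 0 hPγ) hPγ ?_
    rw [pow_zero, mul_one, hQL]
    have : p * (2 * γ + 1) ≤ p * p ^ l := Nat.mul_le_mul_left _ (by omega)
    nlinarith
  | succ a ih =>
    have hdvd : p ^ a ∣ γ := (pow_dvd_pow p (by omega)).trans hPγ
    refine odd_size_step hp5 hQl H hh hb (hal _ hPγ) hPγ ?_
    have h1 := ih hdvd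
    have h2 : p * (γ * (p * p ^ a + 1)) ≤ p * p ^ l := Nat.mul_le_mul_left _ h1
    have h3 := Nat.le_of_dvd hγ hPγ
    rw [hQL]
    have h4 : p ^ (a + 1) = p * p ^ a := pow_succ' p a
    rw [h4] at h3 ⊢
    nlinarith

end OddCase

theorem natCast_zmod_ne_zero {p n : ℕ} (h0 : 0 < n) (h : n < p) : (n : ZMod p) ≠ 0 := by
  rw [Ne, ZMod.natCast_eq_zero_iff]
  exact fun hd => absurd (Nat.le_of_dvd h0 hd) (by omega)

theorem odd_case_false {p Q γ l : ℕ} {b h : ℤ} [Fact p.Prime] (hp5 : 5 < p) (hQl : Q = p ^ (l + 1))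
    (H : PlanarIdentities p Q b) (hh : (Q : ℤ) + 1 = 2 * h) (hγ : 0 < γ) (hγL : 2 * γ < p ^ l)
    (hb : (Q : ℤ) + 1 ∣ b * (1 + 2 * p * γ) - 1) : False := by
  have hpp : p.Prime := Fact.out
  obtain ⟨a, γ', hγ', hγa⟩ := Nat.exists_eq_pow_mul_and_not_dvd hγ.ne' p hpp.ne_one
  have hB := odd_size_bound hp5 hQl H hh hγ hγL hb a ⟨γ', hγa⟩
  obtain ⟨α, hα⟩ := hpp.odd_of_ne_two (by omega)
  obtain ⟨P₁, hP₁⟩ : Odd (p ^ a) := (hpp.odd_of_ne_two (by omega)).pow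
  obtain ⟨L₁, hL₁⟩ : Odd (p ^ l) := (hpp.odd_of_ne_two (by omega)).pow
  have hQL : Q = p * p ^ l := by rw [hQl, pow_succ']
  have hα3 : 3 ≤ α := by omega
  have hQα : Q = 2 * (α * p ^ l) + p ^ l := by rw [hQL, hα]; ring
  have hαLe : 3 * p ^ l ≤ α * p ^ l := Nat.mul_le_mul_right _ hα3
  have hPγ : p ^ a ≤ γ := Nat.le_of_dvd hγ ⟨γ', hγa⟩
  set E := γ * (α * p ^ a + P₁) with hE
  have hM : γ * (p * p ^ a) = γ + 2 * E := by
    have : p * p ^ a = 2 * (α * p ^ a) + p ^ a := by rw [hα]; ring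
    rw [this, hP₁, hE]; rw [hP₁]; ring
  have hMz : (γ : ℤ) * (p * (p ^ a : ℕ)) = γ + 2 * E := by exact_mod_cast hM
  have hB' : γ + 2 * E + γ ≤ p ^ l := by rw [mul_add, mul_one, hM] at hB; exact hB
  set P := p ^ a with hP
  set L := p ^ l with hL
  have hEpos : P₁ + 1 ≤ E := by
    have h1 : P ≤ P * γ' * (α * P) := by
      rw [← hγa]
      calc P ≤ γ := hPγ
        _ = γ * 1 := (mul_one _).symm
        _ ≤ γ * (α * P) := Nat.mul_le_mul_left _ (by nlinarith)
    rw [← hγa] at h1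
    have h2 : γ * (α * P) ≤ E := by rw [hE, mul_add]; omega
    omega
  obtain ⟨A, hA⟩ : ∃ A, 2 * A + (3 * P + 1 * L) + 1 = Q := ⟨α * L - 3 * P₁ - 2, by omega⟩
  have hAh : (A : ℤ) < h := by omega
  have hAL : A = L * (α - 1) + (L - 1 - (3 * P₁ + 1)) := by
    obtain ⟨α', rfl⟩ : ∃ α', α = α' + 1 := ⟨α - 1, by omega⟩
    have : (α' + 1) * L = L * α' + L := by ring
    simp only [Nat.add_sub_cancel]
    omega
  have hchoose : ∀ i, i + (3 * P₁ + 1) < L →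
      ((A.choose i : ZMod p) = 0 ↔ (((i + (3 * P₁ + 1)).choose (3 * P₁ + 1) : ℕ) : ZMod p) = 0) := by
    intro i hi
    have h1 : A.choose i = (L * (α - 1) + (L - 1 - (3 * P₁ + 1))).choose (L * 0 + i) := by
      rw [← hAL, mul_zero, zero_add]
    rw [h1, choose_mul_pow_add l _ _ _ _ (by omega) (by omega), Nat.choose_zero_right, Nat.cast_one, one_mul,
      choose_pow_sub_eq_zero_iff hi]
  have hchoose' : ∀ N, (((P * N + (P - 1)).choose (3 * P₁ + 1) : ℕ) : ZMod p) = N * (-1) ^ P₁ := by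
    intro N
    rw [show 3 * P₁ + 1 = P * 1 + P₁ by omega, choose_mul_pow_sub_one a _ _ _ (by omega), Nat.choose_one_right]
  -- even arguments and the diagonal
  have ze : ∀ μ ν, μ % 2 = 0 → pairSum p Q b A μ ν = 0 := fun μ ν => pairSum_eq_zero_of_even hQL hh hb
  have ze' : ∀ μ ν, ν % 2 = 0 → pairSum p Q b A μ ν = 0 := fun μ ν => pairSum_eq_zero_of_even_right hQL hh hb
  have z00 := fun ν => ze (0 * P + 0 * L) ν (by omega)
  have z20 := fun ν => ze (2 * P + 0 * L) ν (by omega)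
  have z11 := fun ν => ze (1 * P + 1 * L) ν (by omega)
  have z31 := fun ν => ze (3 * P + 1 * L) ν (by omega)
  have y00 := fun ν => ze' ν (0 * P + 0 * L) (by omega)
  have y20 := fun ν => ze' ν (2 * P + 0 * L) (by omega)
  have y11 := fun ν => ze' ν (1 * P + 1 * L) (by omega)
  have y31 := fun ν => ze' ν (3 * P + 1 * L) (by omega)
  have zd : ∀ μ, pairSum p Q b A μ μ = 0 := fun μ => pairSum_self_eq_zero hQL hb
  -- pairs excluded by size
  have z1001 : pairSum p Q b A (1 * P + 0 * L) (0 * P + 1 * L) = 0 := by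
    refine pairSum_eq_zero fun i j _ _ hs hd => ?_
    obtain ⟨k, h1, h2⟩ := odd_index_eq (p := p) (L := L) (P := P) (x := -1) (y := 1) (by exact_mod_cast hQL) hb
      (by push_cast; ring) (by exact_mod_cast hs) hd
    have hG : (γ : ℤ) * (p * P * (-1) - 1) = -(2 * γ + 2 * E) := by linear_combination -hMz
    rw [hG] at h1 h2
    rcases mul_trichotomy (N := (Q : ℤ) + 1) (by omega) k with h | h | h | h <;> push_cast at h1 h2 <;> omega
  have z2130 : pairSum p Q b A (2 * P + 1 * L) (3 * P + 0 * L) = 0 :=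
    (pairSum_reflect hA (by ring) (by ring)).trans z1001
  -- pairs with vanishing binomial coefficient
  have z1030 : pairSum p Q b A (1 * P + 0 * L) (3 * P + 0 * L) = 0 := by
    refine pairSum_eq_zero fun i j _ _ hs hd => ?_
    obtain ⟨k, h1, h2⟩ := odd_index_eq (p := p) (L := L) (P := P) (x := 2) (y := 0) (by exact_mod_cast hQL) hb
      (by push_cast; ring) (by exact_mod_cast hs) hd
    have hG : (γ : ℤ) * (p * P * 2 - 0) = 2 * γ + 4 * E := by linear_combination 2 * hMz
    rw [hG] at h1 h2
    have hi : i + P₁ + 1 = γ + 2 * E := by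
      rcases mul_trichotomy (N := (Q : ℤ) + 1) (by omega) k with h | h | h | h <;> push_cast at h1 h2 <;> omega
    have hiτ : i + (3 * P₁ + 1) = P * (p * γ) + (P - 1) := by
      have : P * (p * γ) = γ * (p * P) := by ring
      omega
    rw [(hchoose i (by omega)).mpr, zero_mul]
    rw [hiτ, hchoose']
    simp
  have z2101 : pairSum p Q b A (2 * P + 1 * L) (0 * P + 1 * L) = 0 :=
    (pairSum_reflect hA (by ring) (by ring)).trans z1030
  have hT1 := pairSum_complement (p := p) (μ := 1 * P + 0 * L) (ν := 2 * P + 1 * L) hh (H.coprime h hh) hA (by ring)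
  have hT3 := pairSum_complement (p := p) (μ := 3 * P + 0 * L) (ν := 0 * P + 1 * L) hh (H.coprime h hh) hA (by ring)
  set T₁ := sliceSum p Q b A (3 * P + 1 * L) (1 * P + 0 * L) with hT₁
  set T₃ := sliceSum p Q b A (3 * P + 1 * L) (3 * P + 0 * L) with hT₃
  have hne : T₁ ≠ 0 := by
    obtain ⟨i, hi⟩ : ∃ i, i + P₁ + 1 = E := ⟨E - P₁ - 1, by omega⟩
    obtain ⟨j, hj⟩ : ∃ j, i + j = A := ⟨A - i, by omega⟩
    rw [hT₁, sliceSum_eq_single hh (H.coprime h hh) hAh (i := i) (by omega)]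
    · refine mul_ne_zero (pow_ne_zero _ (neg_ne_zero.mpr one_ne_zero)) ?_
      rw [Ne, hchoose i (by omega)]
      have hiτ : i + (3 * P₁ + 1) = P * (γ' * (α * P + P₁)) + (P - 1) := by
        have : P * (γ' * (α * P + P₁)) = E := by rw [hE, hγa]; ring
        omega
      rw [hiτ, hchoose']
      refine mul_ne_zero ?_ (pow_ne_zero _ (neg_ne_zero.mpr one_ne_zero))
      rw [Ne, ZMod.natCast_eq_zero_iff, hpp.dvd_mul]
      rintro (hd | hd)
      · exact hγ' hd
      · have h1 : 2 * (α * P + P₁) + 1 = p * P := by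
          have : p * P = 2 * (α * P) + P := by rw [hα]; ring
          omega
        have h2 : p ∣ 1 := (Nat.dvd_add_right (hd.mul_left 2)).mp (h1 ▸ dvd_mul_right p P)
        exact hpp.one_lt.ne' (Nat.dvd_one.mp h2)
    · have hd := odd_index_dvd (p := p) (L := L) (P := P) (x := 1) (y := 1) (i := i) (j := j)
        (μ := P) (ν := 2 * P + L) (by exact_mod_cast hQL) hh hb (by ring) (by omega) 1 ?_ ?_
      · convert hd using 1
        have : (j : ℤ) = A - i := by omega
        rw [this]; push_cast; ring
      · have hG : (γ : ℤ) * (p * P * 1 - 1) = 2 * E := by linear_combination hMz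
        rw [hG]; omega
      · have hG : (γ : ℤ) * (p * P * 1 - 1) = 2 * E := by linear_combination hMz
        rw [hG]; omega
  have h2 : (2 : ZMod p) ≠ 0 := by exact_mod_cast natCast_zmod_ne_zero (p := p) (n := 2) (by omega) (by omega)
  have h3 : (3 : ZMod p) ≠ 0 := by exact_mod_cast natCast_zmod_ne_zero (p := p) (n := 3) (by omega) (by omega)
  have hsq : 9 * T₁ ^ 2 + T₃ ^ 2 = 0 := by
    have hsum := H.pair_digits (A := A) (a := a) (l := l) (e₀ := 3) (e₁ := 1) (by omega) (by omega) hA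
    simp only [sum_range_succ, sum_range_zero, zero_add, ← hP, ← hL] at hsum
    have s1 := (pairSum_swap p Q b A (0 * P + 1 * L) (1 * P + 0 * L)).trans z1001
    have s2 := (pairSum_swap p Q b A (3 * P + 0 * L) (2 * P + 1 * L)).trans z2130
    have s3 := (pairSum_swap p Q b A (3 * P + 0 * L) (1 * P + 0 * L)).trans z1030
    have s4 := (pairSum_swap p Q b A (0 * P + 1 * L) (2 * P + 1 * L)).trans z2101
    have s5 := (pairSum_swap p Q b A (2 * P + 1 * L) (1 * P + 0 * L)).trans hT1
    have s6 := (pairSum_swap p Q b A (0 * P + 1 * L) (3 * P + 0 * L)).trans hT3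
    simp only [z00, z20, z11, z31, y00, y20, y11, y31, zd, z1001, z2130, z1030, z2101, s1, s2, s3, s4, s5, s6,
      hT1, hT3, mul_zero, add_zero, zero_add] at hsum
    have c31 : Nat.choose 3 1 = 3 := rfl
    have c32 : Nat.choose 3 2 = 3 := rfl
    simp only [Nat.choose_self, Nat.choose_zero_right, c31, c32, Nat.cast_one, one_mul, mul_one] at hsum
    push_cast at hsum
    have h5 : (2 * (-1) ^ A : ZMod p) * (9 * T₁ ^ 2 + T₃ ^ 2) = 0 := by linear_combination hsum
    exact (mul_eq_zero.mp h5).resolve_left (mul_ne_zero h2 (pow_ne_zero _ (neg_ne_zero.mpr one_ne_zero)))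
  by_cases hp4 : p % 4 = 3
  · refine (ZMod.exists_sq_eq_neg_one_iff (p := p)).mp ⟨T₃ / (3 * T₁), ?_⟩ hp4
    field_simp
    linear_combination -hsq
  · have hp1 : p % 4 = 1 := by omega
    have hP4 : P % 4 = 1 := by rw [hP, Nat.pow_mod, hp1]; simp
    have hAe : Even A := by
      have h5 : α % 2 = 0 := by omega
      obtain ⟨α', hα'⟩ : ∃ α', α = 2 * α' := ⟨α / 2, by omega⟩
      have h6 : α * L = 2 * (α' * L) := by rw [hα']; ring
      rw [Nat.even_iff]
      omega
    have hsum := H.slice_digits (A := A) (a := a) (l := l) (e₀ := 3) (e₁ := 1) (by omega) (by omega) hA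
    simp only [sum_range_succ, sum_range_zero, zero_add, ← hP, ← hL] at hsum
    have ze : ∀ μ, μ % 2 = 0 → sliceSum p Q b A (3 * P + 1 * L) μ = 0 :=
      fun μ => sliceSum_eq_zero_of_even hQL hh hb hA
    have z00 := ze (0 * P + 0 * L) (by omega)
    have z20 := ze (2 * P + 0 * L) (by omega)
    have z11 := ze (1 * P + 1 * L) (by omega)
    have z31 := ze (3 * P + 1 * L) (by omega)
    have s21 : sliceSum p Q b A (3 * P + 1 * L) (2 * P + 1 * L) = T₁ := sliceSum_reflect hAe (by ring)
    have s01 : sliceSum p Q b A (3 * P + 1 * L) (0 * P + 1 * L) = T₃ := sliceSum_reflect hAe (by ring)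
    have o10 : (-1 : ZMod p) ^ (1 * P + 0 * L) = -1 := Odd.neg_one_pow (Nat.odd_iff.mpr (by omega))
    have o30 : (-1 : ZMod p) ^ (3 * P + 0 * L) = -1 := Odd.neg_one_pow (Nat.odd_iff.mpr (by omega))
    have o21 : (-1 : ZMod p) ^ (2 * P + 1 * L) = -1 := Odd.neg_one_pow (Nat.odd_iff.mpr (by omega))
    have o01 : (-1 : ZMod p) ^ (0 * P + 1 * L) = -1 := Odd.neg_one_pow (Nat.odd_iff.mpr (by omega))
    simp only [z00, z20, z11, z31, s21, s01, o10, o30, o21, o01, ← hT₁, ← hT₃, mul_zero, add_zero, zero_add] at hsum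
    have c31 : Nat.choose 3 1 = 3 := rfl
    have c32 : Nat.choose 3 2 = 3 := rfl
    simp only [Nat.choose_self, Nat.choose_zero_right, c31, c32, Nat.cast_one, one_mul, mul_one] at hsum
    push_cast at hsum
    have h5 : (2 : ZMod p) * (3 * T₁ + T₃) = 0 := by linear_combination -hsum
    have h6 := (mul_eq_zero.mp h5).resolve_left h2
    have h7 : (2 * 3 * 3 : ZMod p) * T₁ ^ 2 = 0 := by
      linear_combination hsq + (3 * T₁ - T₃) * h6
    exact mul_ne_zero (mul_ne_zero (mul_ne_zero h2 h3) h3) (pow_ne_zero 2 hne) h7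

section EvenIndex

variable {p Q L γ b h : ℤ}

/-- The divisibility condition for even `b`, solved for the index difference. -/
theorem even_index_eq (hQ : Q = p * L) (hh : Q + 1 = 2 * h) (hho : h % 2 = 1) (hbe : b % 2 = 0)
    (hb : h ∣ b * (2 * p * γ) - 1) {z μ ν x y : ℤ} (hX : ν - μ = x + y * L)
    (hd : 2 * (Q + 1) ∣ (Q + 1) + (ν - μ) - 2 * b * z) :
    (ν - μ) % 4 = 2 ∧ ∃ k : ℤ, z = γ * (p * x - y) + h * k := by
  obtain ⟨t, ht⟩ := hb
  obtain ⟨u, hu⟩ := hd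
  obtain ⟨b', rfl⟩ : ∃ b', b = 2 * b' := ⟨b / 2, by omega⟩
  constructor
  · rw [hh] at hu
    have h1 : 2 * (2 * h) * u = 4 * (h * u) := by ring
    have h2 : 2 * (2 * b') * z = 4 * (b' * z) := by ring
    rw [h1, h2] at hu
    omega
  · refine ⟨2 * γ * y - p * γ * (4 * u - 2) - t * z, ?_⟩
    subst hQ
    linear_combination (-z) * ht - p * γ * hu + (p * γ * (1 - 2 * u) + γ * y) * hh + p * γ * hX

theorem even_index_dvd (hQ : Q = p * L) (hh : Q + 1 = 2 * h) (hho : h % 2 = 1) (hbe : b % 2 = 0)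
    (hb : h ∣ b * (2 * p * γ) - 1) {z μ ν x y : ℤ} (hX : ν - μ = x + y * L) (hX4 : (ν - μ) % 4 = 2) (k : ℤ)
    (hz : z = γ * (p * x - y) + h * k) :
    2 * (Q + 1) ∣ (Q + 1) + (ν - μ) - 2 * b * z := by
  obtain ⟨t, ht⟩ := hb
  have h4 : (4 : ℤ) ∣ (Q + 1) + (ν - μ) - 2 * b * z := by
    obtain ⟨b', rfl⟩ : ∃ b', b = 2 * b' := ⟨b / 2, by omega⟩
    have h2 : 2 * (2 * b') * z = 4 * (b' * z) := by ring
    rw [h2]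
    omega
  have hhd : h ∣ (Q + 1) + (ν - μ) - 2 * b * z := by
    refine ⟨2 - t * (ν - μ) - 2 * b * (k - 2 * γ * y), ?_⟩
    subst hQ
    linear_combination (-2 * b) * hz + (1 + 2 * b * γ * y) * hh - (ν - μ) * ht + 2 * p * γ * b * hX
  have hcop : IsCoprime (4 : ℤ) h := by
    have h2 : IsCoprime (2 : ℤ) h := ⟨-(h / 2), 1, by omega⟩
    have := h2.mul_left h2
    norm_num at this
    exact this
  rw [show 2 * (Q + 1) = 4 * h by rw [hh]; ring]
  exact hcop.mul_dvd h4 hhd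

end EvenIndex

section EvenCase

variable {p Q L γ : ℕ} {b h : ℤ}

theorem pairSum_eq_zero_of_mod_four (hQ : Q = p * L) (hh : (Q : ℤ) + 1 = 2 * h) (hho : h % 2 = 1)
    (hbe : b % 2 = 0) (hb : h ∣ b * (2 * p * γ) - 1) {A μ ν : ℕ} (hμ : ((ν : ℤ) - μ) % 4 ≠ 2) :
    pairSum p Q b A μ ν = 0 :=
  pairSum_eq_zero fun i j _ _ _ hd =>
    absurd (even_index_eq (p := p) (L := L) (γ := γ) (x := ν - μ) (y := 0) (by exact_mod_cast hQ) hh hho hbe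
      (by exact_mod_cast hb) (by ring) hd).1 hμ

theorem sliceSum_eq_zero_of_mod_four (hQ : Q = p * L) (hh : (Q : ℤ) + 1 = 2 * h) (hho : h % 2 = 1)
    (hbe : b % 2 = 0) (hb : h ∣ b * (2 * p * γ) - 1) {A ε μ : ℕ} (hμ : ((ε : ℤ) - 2 * μ) % 4 ≠ 2) :
    sliceSum p Q b A ε μ = 0 :=
  sliceSum_eq_zero fun i _ hd => hμ <| by
    have := (even_index_eq (p := p) (L := L) (γ := γ) (x := ε - 2 * μ) (y := 0) (z := 2 * i - A) (μ := μ)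
      (ν := ε - μ) (by exact_mod_cast hQ) hh hho hbe (by exact_mod_cast hb) (by ring)
      (by convert hd using 1; ring)).1
    omega

theorem even_case_false_of_one_mod_four [Fact p.Prime] (hp5 : 5 < p) (hp4 : p % 4 = 1) {l : ℕ}
    (hQl : Q = p ^ (l + 1)) (H : PlanarIdentities p Q b) (hh : (Q : ℤ) + 1 = 2 * h) (hho : h % 2 = 1)
    (hbe : b % 2 = 0) (hγ : 0 < γ) (hγQ : 2 * p * γ < Q + 1)
    (hb : h ∣ b * (2 * p * γ) - 1) : False := by
  have hpp : p.Prime := Fact.out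
  obtain ⟨α, hα⟩ := hpp.odd_of_ne_two (by omega)
  have hQL : Q = p * p ^ l := by rw [hQl, pow_succ']
  have hL4 : p ^ l % 4 = 1 := by rw [Nat.pow_mod, hp4]; simp
  have hα3 : 4 ≤ α := by omega
  have hQα : Q = 2 * (α * p ^ l) + p ^ l := by rw [hQL, hα]; ring
  have hαLe : 4 * p ^ l ≤ α * p ^ l := Nat.mul_le_mul_right _ hα3
  obtain ⟨g, hg⟩ : ∃ g, α = 2 * g + 2 := ⟨(α - 2) / 2, by omega⟩
  set W := α * γ with hW
  have hpγ : p * γ = 2 * W + γ := by rw [hα, hW]; ring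
  have hpγz : (p : ℤ) * γ = 2 * W + γ := by exact_mod_cast hpγ
  have hγQ' : 4 * W + 2 * γ < Q + 1 := by
    have : 2 * p * γ = 2 * (p * γ) := by ring
    omega
  have hWγ : 4 * γ ≤ W := Nat.mul_le_mul_right _ hα3
  have hgL : α * p ^ l = 2 * (g * p ^ l) + 2 * p ^ l := by rw [hg]; ring
  obtain ⟨P, hP⟩ : ∃ P, P = p ^ 0 := ⟨_, rfl⟩
  have hP1 : P = 1 := by rw [hP, pow_zero]
  set L := p ^ l with hL
  have hcop := H.coprime h hh
  have h2 : (2 : ZMod p) ≠ 0 := by exact_mod_cast natCast_zmod_ne_zero (p := p) (n := 2) (by omega) (by omega)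
  have hm1 : ∀ k : ℕ, (-1 : ZMod p) ^ k ≠ 0 := fun k => pow_ne_zero _ (neg_ne_zero.mpr one_ne_zero)
  have hsize : 4 * W < L := by
    by_contra hcon
    obtain ⟨A, hA⟩ : ∃ A, 2 * A + (1 * P + 1 * L) + 1 = Q := ⟨α * L - 1, by omega⟩
    obtain ⟨i, hi⟩ : ∃ i, 4 * i + L + 3 = 4 * W := ⟨(4 * W - L - 3) / 4, by omega⟩
    obtain ⟨j, hj⟩ : ∃ j, i + j = A := ⟨A - i, by omega⟩
    have hval : pairSum p Q b A (0 * P + 0 * L) (1 * P + 1 * L) = (-1) ^ (i + j) * A.choose i * A.choose j := by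
      refine pairSum_eq_single hh hcop (by omega) (by omega) (by omega) (by omega) ?_
      refine even_index_dvd (p := p) (L := L) (γ := γ) (x := 1) (y := 1) (by exact_mod_cast hQL) hh hho hbe hb
        (by push_cast; rw [hP1]; ring) (by push_cast; omega) (-1) ?_
      have : (γ : ℤ) * (p * 1 - 1) = 2 * W := by linear_combination hpγz
      rw [this]
      omega
    have hsum := H.pair_digits (A := A) (a := 0) (l := l) (e₀ := 1) (e₁ := 1) (by omega) (by omega) (hP ▸ hA)
    simp only [sum_range_succ, sum_range_zero, zero_add, ← hP, ← hL] at hsum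
    have z : ∀ μ ν : ℕ, ((ν : ℤ) - μ) % 4 ≠ 2 → pairSum p Q b A μ ν = 0 :=
      fun μ ν => pairSum_eq_zero_of_mod_four hQL hh hho hbe hb
    have s := pairSum_swap p Q b A (1 * P + 1 * L) (0 * P + 0 * L)
    simp (disch := (push_cast; omega)) only [z, s, hval, mul_zero, add_zero, zero_add] at hsum
    simp only [Nat.choose_self, Nat.choose_zero_right, Nat.cast_one, one_mul] at hsum
    rw [← two_mul] at hsum
    have hne : (A.choose i : ZMod p) ≠ 0 := by
      have hAL : A = L * (α - 1) + (L - 1) := by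
        obtain ⟨α', hα'⟩ : ∃ α', α = α' + 1 := ⟨α - 1, by omega⟩
        have : α * L = L * α' + L := by rw [hα']; ring
        rw [hα', Nat.add_sub_cancel]
        omega
      have hle : i ≤ L * (α - 1) + (L - 1) := by omega
      rw [hAL]
      exact choose_mul_pow_sub_one_ne_zero (by omega) hle
    have hCj : A.choose j = A.choose i := by rw [← hj, Nat.choose_symm_add]
    rw [hCj] at hsum
    exact mul_ne_zero h2 (mul_ne_zero (mul_ne_zero (hm1 _) hne) hne) hsum
  obtain ⟨A', hA'⟩ : ∃ A', 2 * (2 * A') + (1 * P + 3 * L) + 1 = Q := ⟨g * L + L / 2, by omega⟩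
  obtain ⟨A, hAA⟩ : ∃ A, A = 2 * A' := ⟨_, rfl⟩
  have hA : 2 * A + (1 * P + 3 * L) + 1 = Q := by rw [hAA, hA']
  have hAe : Even A := ⟨A', by omega⟩
  have hAL : A = L * (2 * g) + (L - 1) := by
    have : L * (2 * g) = 2 * (g * L) := by ring
    omega
  have hgL' : L * g = g * L := mul_comm _ _
  have hT1 : sliceSum p Q b A (1 * P + 3 * L) (1 * P + 0 * L) ^ 2 = ((2 * g).choose g : ZMod p) ^ 2 := by
    obtain ⟨y, hy⟩ : ∃ y, 2 * y + 2 * W + 4 * γ + 1 = L := ⟨(L - 1 - 2 * W - 4 * γ) / 2, by omega⟩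
    rw [sliceSum_eq_single hh hcop (by omega) (i := L * g + y) (by omega)]
    · rw [hAL, choose_mul_pow_sub_one _ _ _ _ (by omega), mul_pow, mul_pow, ← pow_mul, ← pow_mul, mul_comm _ 2,
        mul_comm _ 2, pow_mul, pow_mul]
      simp
    · have := even_index_dvd (p := p) (L := L) (γ := γ) (x := -1) (y := 3) (z := 2 * (L * g + y : ℕ) - A)
        (μ := 1) (ν := 3 * L) (by exact_mod_cast hQL) hh hho hbe hb (by ring) (by omega) 0 (by
          have : (γ : ℤ) * (p * (-1) - 3) = -(2 * W + 4 * γ) := by linear_combination -hpγz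
          rw [this]
          omega)
      convert this using 1
      rw [hP1]; push_cast; ring
  have hT2 : sliceSum p Q b A (1 * P + 3 * L) (0 * P + 1 * L) ^ 2 = ((2 * g).choose g : ZMod p) ^ 2 := by
    obtain ⟨y, hy⟩ : ∃ y, 2 * y + 1 = 2 * W + L := ⟨(2 * W + L - 1) / 2, by omega⟩
    rw [sliceSum_eq_single hh hcop (by omega) (i := L * g + y) (by omega)]
    · rw [hAL, choose_mul_pow_sub_one _ _ _ _ (by omega), mul_pow, mul_pow, ← pow_mul, ← pow_mul, mul_comm _ 2,
        mul_comm _ 2, pow_mul, pow_mul]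
      simp
    · have := even_index_dvd (p := p) (L := L) (γ := γ) (x := 1) (y := 1) (z := 2 * (L * g + y : ℕ) - A)
        (μ := L) (ν := 1 + 2 * L) (by exact_mod_cast hQL) hh hho hbe hb (by ring) (by omega) 0 (by
          have : (γ : ℤ) * (p * 1 - 1) = 2 * W := by linear_combination hpγz
          rw [this]
          omega)
      convert this using 1
      rw [hP1]; push_cast; ring
  have hsum := H.slice_digits (A := A) (a := 0) (l := l) (e₀ := 1) (e₁ := 3) (by omega) (by omega) (hP ▸ hA)
  simp only [sum_range_succ, sum_range_zero, zero_add, ← hP, ← hL] at hsum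
  have z : ∀ μ : ℕ, (((1 * P + 3 * L : ℕ) : ℤ) - 2 * μ) % 4 ≠ 2 → sliceSum p Q b A (1 * P + 3 * L) μ = 0 :=
    fun μ => sliceSum_eq_zero_of_mod_four hQL hh hho hbe hb
  have s12 : sliceSum p Q b A (1 * P + 3 * L) (1 * P + 2 * L) = sliceSum p Q b A (1 * P + 3 * L) (0 * P + 1 * L) :=
    sliceSum_reflect hAe (by ring)
  have s03 : sliceSum p Q b A (1 * P + 3 * L) (0 * P + 3 * L) = sliceSum p Q b A (1 * P + 3 * L) (1 * P + 0 * L) :=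
    sliceSum_reflect hAe (by ring)
  have o10 : (-1 : ZMod p) ^ (1 * P + 0 * L) = -1 := Odd.neg_one_pow (Nat.odd_iff.mpr (by omega))
  have o01 : (-1 : ZMod p) ^ (0 * P + 1 * L) = -1 := Odd.neg_one_pow (Nat.odd_iff.mpr (by omega))
  have o12 : (-1 : ZMod p) ^ (1 * P + 2 * L) = -1 := Odd.neg_one_pow (Nat.odd_iff.mpr (by omega))
  have o03 : (-1 : ZMod p) ^ (0 * P + 3 * L) = -1 := Odd.neg_one_pow (Nat.odd_iff.mpr (by omega))
  simp (disch := (push_cast; omega)) only [z, s12, s03, o10, o01, o12, o03, mul_zero, add_zero, zero_add] at hsum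
  set T₁ := sliceSum p Q b A (1 * P + 3 * L) (1 * P + 0 * L)
  set T₂ := sliceSum p Q b A (1 * P + 3 * L) (0 * P + 1 * L)
  have c31 : Nat.choose 3 1 = 3 := rfl
  have c32 : Nat.choose 3 2 = 3 := rfl
  simp only [Nat.choose_self, Nat.choose_zero_right, c31, c32, Nat.cast_one, one_mul, mul_one] at hsum
  push_cast at hsum
  have h5 : (2 : ZMod p) * (T₁ + 3 * T₂) = 0 := by linear_combination -hsum
  have h6 := (mul_eq_zero.mp h5).resolve_left h2
  have h7 : (2 * 2 * 2 : ZMod p) * ((2 * g).choose g : ZMod p) ^ 2 = 0 := by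
    linear_combination hT1 - 9 * hT2 - (T₁ - 3 * T₂) * h6
  exact mul_ne_zero (mul_ne_zero (mul_ne_zero h2 h2) h2)
    (pow_ne_zero 2 (choose_ne_zero_of_lt (by omega) (by omega))) h7

end EvenCase

section EvenCaseThreeModFour

variable {p Q γ : ℕ} {b h : ℤ}

theorem even_size_of_three_mod_four [Fact p.Prime] (hp5 : 5 < p) {l α : ℕ} (hα : p = 2 * α + 1) (hα2 : α % 2 = 1)
    (hL4 : p ^ l % 4 = 3)
    (hQL : Q = p * p ^ l) (H : PlanarIdentities p Q b) (hh : (Q : ℤ) + 1 = 2 * h) (hho : h % 2 = 1)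
    (hbe : b % 2 = 0) (hb : h ∣ b * (2 * p * γ) - 1) : Q + 2 ≤ 4 * ((α + 1) * γ) + p ^ l := by
  by_contra hcon
  have hα3 : 3 ≤ α := by omega
  have hQα : Q = 2 * (α * p ^ l) + p ^ l := by rw [hQL, hα]; ring
  have hαLe : 3 * p ^ l ≤ α * p ^ l := Nat.mul_le_mul_right _ hα3
  obtain ⟨g, hg⟩ : ∃ g, α = 2 * g + 1 := ⟨α / 2, by omega⟩
  have hgL : α * p ^ l = 2 * (g * p ^ l) + p ^ l := by rw [hg]; ring
  set W := (α + 1) * γ with hW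
  have hpγ : (p + 1) * γ = 2 * W := by rw [hα, hW]; ring
  have hpγz : ((p : ℤ) + 1) * γ = 2 * W := by exact_mod_cast hpγ
  obtain ⟨P, hP⟩ : ∃ P, P = p ^ 0 := ⟨_, rfl⟩
  have hP1 : P = 1 := by rw [hP, pow_zero]
  set L := p ^ l with hL
  have h2 : (2 : ZMod p) ≠ 0 := by exact_mod_cast natCast_zmod_ne_zero (p := p) (n := 2) (by omega) (by omega)
  have hm1 : ∀ k : ℕ, (-1 : ZMod p) ^ k ≠ 0 := fun k => pow_ne_zero _ (neg_ne_zero.mpr one_ne_zero)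
  obtain ⟨A, hA⟩ : ∃ A, 2 * A + (1 * P + 1 * L) + 1 = Q := ⟨α * L - 1, by omega⟩
  obtain ⟨i, hi⟩ : ∃ i, 2 * i + 2 * W = A := ⟨(A - 2 * W) / 2, by omega⟩
  obtain ⟨j, hj⟩ : ∃ j, i + j = A := ⟨A - i, by omega⟩
  have hval : pairSum p Q b A (1 * P + 0 * L) (0 * P + 1 * L) = (-1) ^ (i + j) * A.choose i * A.choose j := by
    refine pairSum_eq_single hh (H.coprime h hh) (by omega) (by omega) (by omega) (by omega) ?_
    refine even_index_dvd (p := p) (L := L) (γ := γ) (x := -1) (y := 1) (by exact_mod_cast hQL) hh hho hbe hb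
      (by push_cast; rw [hP1]; ring) (by push_cast; omega) 0 ?_
    have : (γ : ℤ) * (p * (-1) - 1) = -(2 * W) := by linear_combination -hpγz
    rw [this]
    omega
  have hsum := H.pair_digits (A := A) (a := 0) (l := l) (e₀ := 1) (e₁ := 1) (by omega) (by omega) (hP ▸ hA)
  simp only [sum_range_succ, sum_range_zero, zero_add, ← hP, ← hL] at hsum
  have z : ∀ μ ν : ℕ, ((ν : ℤ) - μ) % 4 ≠ 2 → pairSum p Q b A μ ν = 0 :=
    fun μ ν => pairSum_eq_zero_of_mod_four hQL hh hho hbe hb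
  have s := pairSum_swap p Q b A (0 * P + 1 * L) (1 * P + 0 * L)
  simp (disch := (push_cast; omega)) only [z, s, hval, mul_zero, add_zero, zero_add] at hsum
  simp only [Nat.choose_self, Nat.choose_zero_right, Nat.cast_one, one_mul] at hsum
  rw [← two_mul] at hsum
  have hne : (A.choose i : ZMod p) ≠ 0 := by
    have hAL : A = L * (α - 1) + (L - 1) := by
      obtain ⟨α', hα'⟩ : ∃ α', α = α' + 1 := ⟨α - 1, by omega⟩
      have : α * L = L * α' + L := by rw [hα']; ring
      rw [hα', Nat.add_sub_cancel]
      omega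
    have hle : i ≤ L * (α - 1) + (L - 1) := by omega
    rw [hAL]
    exact choose_mul_pow_sub_one_ne_zero (by omega) hle
  have hCj : A.choose j = A.choose i := by rw [← hj, Nat.choose_symm_add]
  rw [hCj] at hsum
  exact mul_ne_zero h2 (mul_ne_zero (mul_ne_zero (hm1 _) hne) hne) hsum

set_option maxHeartbeats 1600000 in
theorem even_case_false_of_three_mod_four [Fact p.Prime] (hp5 : 5 < p) (hp4 : p % 4 = 3) {l : ℕ}
    (hQl : Q = p ^ (l + 1)) (H : PlanarIdentities p Q b) (hh : (Q : ℤ) + 1 = 2 * h) (hho : h % 2 = 1)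
    (hbe : b % 2 = 0) (hγQ : 2 * p * γ < Q + 1)
    (hb : h ∣ b * (2 * p * γ) - 1) : False := by
  have hpp : p.Prime := Fact.out
  obtain ⟨g, hg⟩ : ∃ g, p = 4 * g + 3 := ⟨p / 4, by omega⟩
  have hg1 : 1 ≤ g := by omega
  have hQL : Q = p * p ^ l := by rw [hQl, pow_succ']
  have hL4 : p ^ l % 4 = 3 := by
    have h1 : (p * p ^ l) % 4 = 1 := by rw [← hQL]; omega
    rw [Nat.mul_mod, hp4] at h1
    have : p ^ l % 4 < 4 := Nat.mod_lt _ (by norm_num)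
    interval_cases h3 : p ^ l % 4 <;> simp_all
  have hsize := even_size_of_three_mod_four hp5 (α := 2 * g + 1) (by omega) (by omega) hL4 hQL H hh hho hbe hb
  have hQg : Q = 4 * (g * p ^ l) + 3 * p ^ l := by rw [hQL, hg]; ring
  have hgL1 : 1 * p ^ l ≤ g * p ^ l := Nat.mul_le_mul_right _ hg1
  obtain ⟨P, hP⟩ : ∃ P, P = p ^ 0 := ⟨_, rfl⟩
  have hP1 : P = 1 := by rw [hP, pow_zero]
  set L := p ^ l with hL
  obtain ⟨L₂, hL₂⟩ : ∃ L₂, L = 4 * L₂ + 3 := ⟨L / 4, by omega⟩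
  set V := p * γ with hV
  have hVQ : 2 * V ≤ Q := by
    have : 2 * p * γ = 2 * V := by rw [hV]; ring
    omega
  have hVz : (p : ℤ) * γ = V := by rw [hV]; push_cast; ring
  have hsize' : Q + 2 ≤ 2 * V + 2 * γ + L := by
    have : 4 * ((2 * g + 1 + 1) * γ) = 2 * V + 2 * γ := by rw [hV, hg]; ring
    omega
  have hγL : 2 * γ < L := by
    by_contra hcon
    have h1 : p * L ≤ p * (2 * γ) := Nat.mul_le_mul_left _ (by omega)
    have h2 : p * (2 * γ) = 2 * V := by rw [hV]; ring
    have h3 : Q % 2 = 1 := by omega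
    omega
  have hVg : V = 4 * (g * γ) + 3 * γ := by rw [hV, hg]; ring
  have hγL' : 3 * L ≤ 8 * γ := by
    by_contra hcon
    have h1 : g * (8 * γ + 1) ≤ g * (3 * L) := Nat.mul_le_mul_left _ (by omega)
    have h2 : g * (8 * γ + 1) = 8 * (g * γ) + g := by ring
    have h3 : g * (3 * L) = 3 * (g * L) := by ring
    omega
  obtain ⟨A, hA⟩ : ∃ A, 2 * A + (1 * P + 3 * L) + 1 = Q := ⟨2 * (g * L) - 1, by omega⟩
  have hAL : A = L * (2 * g - 1) + (L - 1) := by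
    obtain ⟨g', hg'⟩ : ∃ g', g = g' + 1 := ⟨g - 1, by omega⟩
    have h1 : L * (2 * g - 1) = 2 * (g' * L) + L := by
      rw [hg', show 2 * (g' + 1) - 1 = 2 * g' + 1 by omega]; ring
    have h2 : g * L = g' * L + L := by rw [hg']; ring
    omega
  have hcop := H.coprime h hh
  have hAh : (A : ℤ) < h := by omega
  have hAodd : (-1 : ZMod p) ^ A = -1 := Odd.neg_one_pow (Nat.odd_iff.mpr (by omega))
  have hchoose : ∀ i k y, i = L * k + y → y < L → (A.choose i : ZMod p) = (2 * g - 1).choose k * (-1) ^ y := by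
    intro i k y hi hy
    rw [hi, hAL, choose_mul_pow_sub_one _ _ _ _ hy]
  have hchoose2 : ∀ i k y, i = L * k + y → y < L →
      (A.choose i : ZMod p) ^ 2 = ((2 * g - 1).choose k : ZMod p) ^ 2 := by
    intro i k y hi hy
    rw [hchoose i k y hi hy, mul_pow, ← pow_mul, mul_comm y, pow_mul]
    simp
  have hgm : L * (g - 1) + L = g * L := by
    obtain ⟨g', hg'⟩ : ∃ g', g = g' + 1 := ⟨g - 1, by omega⟩
    rw [hg', Nat.add_sub_cancel]; ring
  have hgp : L * (g + 1) = g * L + L := by ring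
  have hgg : L * g = g * L := mul_comm _ _
  have hsymm : (2 * g - 1).choose (g - 1) = (2 * g - 1).choose g := by
    rw [← Nat.choose_symm (by omega : g - 1 ≤ 2 * g - 1)]
    congr 1; omega
  set c : ZMod p := ((2 * g - 1).choose g : ZMod p) with hc
  have hc0 : c ≠ 0 := choose_ne_zero_of_lt (by omega) (by omega)
  have index : ∀ (μ ν i j : ℕ) (x y : ℤ), 2 * ((Q : ℤ) + 1) ∣ (Q + 1) + (ν - μ) - 2 * b * (i - j) →
      (ν : ℤ) - μ = x + y * L → ∃ k : ℤ, (i : ℤ) - j = γ * (p * x - y) + h * k := by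
    intro μ ν i j x y hd hX
    exact (even_index_eq (p := p) (L := L) (γ := γ) (by exact_mod_cast hQL) hh hho hbe hb hX hd).2
  have hmod : ∀ k : ℤ, (h * k) % 2 = k % 2 := by
    intro k; rw [Int.mul_emod, hho]; simp
  have zsize1 : pairSum p Q b A (0 * P + 0 * L) (0 * P + 2 * L) = 0 := by
    refine pairSum_eq_zero fun i j _ _ hs hd => ?_
    obtain ⟨k, hk⟩ := index _ _ i j 0 2 hd (by push_cast; ring)
    have hY : (γ : ℤ) * (p * 0 - 2) = -(2 * γ) := by ring
    rw [hY] at hk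
    rcases mul_trichotomy (N := h) (by omega) k with h' | h' | h' | h' <;> omega
  have zsize2 : pairSum p Q b A (1 * P + 1 * L) (1 * P + 3 * L) = 0 := by
    rw [pairSum_swap]
    exact (pairSum_reflect hA (by ring) (by ring)).trans zsize1
  have zsize3 : pairSum p Q b A (1 * P + 0 * L) (0 * P + 1 * L) = 0 := by
    refine pairSum_eq_zero fun i j _ _ hs hd => ?_
    obtain ⟨k, hk⟩ := index _ _ i j (-1) 1 hd (by push_cast; rw [hP1]; ring)
    have hY : (γ : ℤ) * (p * (-1) - 1) = -(V + γ) := by linear_combination -hVz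
    rw [hY] at hk
    rcases mul_trichotomy (N := h) (by omega) k with h' | h' | h' | h' <;> omega
  have zsize4 : pairSum p Q b A (0 * P + 3 * L) (1 * P + 2 * L) = 0 :=
    (pairSum_reflect hA (by ring) (by ring)).trans zsize3
  have v1012 : pairSum p Q b A (1 * P + 0 * L) (1 * P + 2 * L) = -c ^ 2 := by
    obtain ⟨y₁, hy₁⟩ : ∃ y₁, y₁ + γ = L + L₂ := ⟨L + L₂ - γ, by omega⟩
    rw [pairSum_eq_single hh hcop hAh (i := L * (g - 1) + y₁) (j := L * g + (L₂ + γ)) (by omega) (by omega)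
      (by omega)]
    · rw [hchoose _ _ _ rfl (by omega), hchoose _ _ _ rfl (by omega), hsymm, ← hc]
      have e1 : (-1 : ZMod p) ^ (L * (g - 1) + y₁ + (L * g + (L₂ + γ))) = 1 :=
        Even.neg_one_pow (Nat.even_iff.mpr (by omega))
      have e2 : (-1 : ZMod p) ^ y₁ * (-1) ^ (L₂ + γ) = -1 := by
        rw [← pow_add]
        exact Odd.neg_one_pow (Nat.odd_iff.mpr (by omega))
      rw [e1]
      linear_combination c ^ 2 * e2
    · refine even_index_dvd (p := p) (L := L) (γ := γ) (x := 0) (y := 2) (by exact_mod_cast hQL) hh hho hbe hb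
        (by push_cast; ring) (by push_cast; omega) 0 ?_
      have hY : (γ : ℤ) * (p * 0 - 2) = -(2 * γ) := by ring
      rw [hY]
      push_cast
      have e1 : ((L : ℤ) * (g - 1 : ℕ)) + L = g * L := by exact_mod_cast hgm
      have e2 : (L : ℤ) * g = g * L := mul_comm _ _
      omega
  have v0301 : pairSum p Q b A (0 * P + 3 * L) (0 * P + 1 * L) = -c ^ 2 :=
    (pairSum_reflect hA (by ring) (by ring)).trans v1012
  have v1102 : pairSum p Q b A (1 * P + 1 * L) (0 * P + 2 * L) = -c ^ 2 := by
    rw [pairSum_complement (ε := 1 * P + 3 * L) hh hcop hA (by ring), hAodd]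
    obtain ⟨i, hi⟩ : ∃ i : ℕ, 2 * (i : ℤ) = A + (h - V - γ) :=
      ⟨((A + (h - V - γ)) / 2).toNat, by
        have := hmod 1
        omega⟩
    rw [sliceSum_eq_single hh hcop hAh (i := i) (by omega)]
    · have : (A.choose i : ZMod p) ^ 2 = c ^ 2 := by
        by_cases hig : i < g * L
        · rw [hchoose2 i (g - 1) (i - L * (g - 1)) (by omega) (by omega), hsymm]
        · rw [hchoose2 i g (i - L * g) (by omega) (by omega)]
      rw [mul_pow, this, ← pow_mul, mul_comm i, pow_mul]
      simp
    · have := even_index_dvd (p := p) (L := L) (γ := γ) (x := -1) (y := 1) (z := 2 * i - A)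
        (μ := 1 + L) (ν := 2 * L) (by exact_mod_cast hQL) hh hho hbe hb (by ring) (by omega) 1 (by
          have : (γ : ℤ) * (p * (-1) - 1) = -(V + γ) := by linear_combination -hVz
          rw [this]
          omega)
      convert this using 1
      rw [hP1]; push_cast; ring
  obtain ⟨j, hj⟩ : ∃ j : ℕ, 2 * (j : ℤ) = A + (h - V + 3 * γ) :=
    ⟨((A + (h - V + 3 * γ)) / 2).toNat, by
      have := hmod 1
      omega⟩
  have v0013 : pairSum p Q b A (0 * P + 0 * L) (1 * P + 3 * L) = -(A.choose j : ZMod p) ^ 2 := by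
    have hY : (γ : ℤ) * (p * 1 - 3) = V - 3 * γ := by linear_combination hVz
    by_cases hjA : j ≤ A
    · rw [pairSum_complement (ε := 1 * P + 3 * L) hh hcop hA (by ring), hAodd]
      rw [sliceSum_eq_single hh hcop hAh (i := A - j) (by omega)]
      · rw [Nat.choose_symm hjA, mul_pow, ← pow_mul, mul_comm (A - j), pow_mul]
        simp
      · have := even_index_dvd (p := p) (L := L) (γ := γ) (x := 1) (y := 3) (z := 2 * (A - j : ℕ) - A)
          (μ := 0) (ν := 1 + 3 * L) (by exact_mod_cast hQL) hh hho hbe hb (by ring) (by omega) (-1) (by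
            rw [hY]
            omega)
        convert this using 1
        rw [hP1]; push_cast; ring
    · rw [Nat.choose_eq_zero_of_lt (by omega)]
      simp only [Nat.cast_zero, ne_eq, OfNat.ofNat_ne_zero, not_false_eq_true, zero_pow, neg_zero]
      refine pairSum_eq_zero fun i i' _ _ hs hd => ?_
      obtain ⟨k, hk⟩ := index _ _ i i' 1 3 hd (by push_cast; rw [hP1]; ring)
      rw [hY] at hk
      have := hmod 1
      have hk1 : h * k = h * (k + 1) - h := by ring
      rw [hk1] at hk
      rcases mul_trichotomy (N := h) (by omega) (k + 1) with h' | h' | h' | h' <;> omega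
  have hsum := H.pair_digits (A := A) (a := 0) (l := l) (e₀ := 1) (e₁ := 3) (by omega) (by omega) (hP ▸ hA)
  simp only [sum_range_succ, sum_range_zero, zero_add, ← hP, ← hL] at hsum
  have z : ∀ μ ν : ℕ, ((ν : ℤ) - μ) % 4 ≠ 2 → pairSum p Q b A μ ν = 0 :=
    fun μ ν => pairSum_eq_zero_of_mod_four hQL hh hho hbe hb
  have s1 := (pairSum_swap p Q b A (0 * P + 2 * L) (0 * P + 0 * L)).trans zsize1
  have s2 := (pairSum_swap p Q b A (1 * P + 3 * L) (1 * P + 1 * L)).trans zsize2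
  have s3 := (pairSum_swap p Q b A (0 * P + 1 * L) (1 * P + 0 * L)).trans zsize3
  have s4 := (pairSum_swap p Q b A (1 * P + 2 * L) (0 * P + 3 * L)).trans zsize4
  have s5 := (pairSum_swap p Q b A (1 * P + 2 * L) (1 * P + 0 * L)).trans v1012
  have s6 := (pairSum_swap p Q b A (0 * P + 1 * L) (0 * P + 3 * L)).trans v0301
  have s7 := (pairSum_swap p Q b A (0 * P + 2 * L) (1 * P + 1 * L)).trans v1102
  have s8 := (pairSum_swap p Q b A (1 * P + 3 * L) (0 * P + 0 * L)).trans v0013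
  simp only [zsize1, zsize2, zsize3, zsize4, v1012, v0301, v1102, v0013, s1, s2, s3, s4, s5, s6, s7, s8] at hsum
  simp (disch := (push_cast; omega)) only [z, mul_zero, add_zero, zero_add] at hsum
  have c31 : Nat.choose 3 1 = 3 := rfl
  have c32 : Nat.choose 3 2 = 3 := rfl
  simp only [Nat.choose_self, Nat.choose_zero_right, c31, c32, Nat.cast_one, one_mul, mul_one] at hsum
  push_cast at hsum
  have h2 : (2 : ZMod p) ≠ 0 := by exact_mod_cast natCast_zmod_ne_zero (p := p) (n := 2) (by omega) (by omega)
  have hfin : (2 : ZMod p) * ((A.choose j : ZMod p) ^ 2 + 15 * c ^ 2) = 0 := by linear_combination -hsum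
  have hfin' := (mul_eq_zero.mp hfin).resolve_left h2
  by_cases hjg : j < g * L + L
  · rw [hchoose2 j g (j - L * g) (by omega) (by omega), ← hc] at hfin'
    have : (2 ^ 4 : ZMod p) * c ^ 2 = 0 := by linear_combination hfin'
    exact mul_ne_zero (pow_ne_zero _ h2) (pow_ne_zero _ hc0) this
  · rw [hchoose2 j (g + 1) (j - L * (g + 1)) (by omega) (by omega)] at hfin'
    have h8 := Nat.choose_succ_right_eq (2 * g - 1) g
    have h9 := congrArg (Nat.cast (R := ZMod p)) h8
    rw [show 2 * g - 1 - g = g - 1 by omega] at h9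
    push_cast [Nat.cast_sub hg1] at h9
    have h10 : (4 * g + 3 : ZMod p) = 0 := by
      have : ((4 * g + 3 : ℕ) : ZMod p) = 0 := by rw [← hg]; exact CharP.cast_eq_zero _ _
      exact_mod_cast this
    rw [← hc] at h9
    have h11 : ((2 * g - 1).choose (g + 1) : ZMod p) = -7 * c := by
      linear_combination 4 * h9 + (c - ((2 * g - 1).choose (g + 1) : ZMod p)) * h10
    rw [h11] at hfin'
    have : (2 ^ 6 : ZMod p) * c ^ 2 = 0 := by linear_combination hfin'
    exact mul_ne_zero (pow_ne_zero _ h2) (pow_ne_zero _ hc0) this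

end EvenCaseThreeModFour

section NormSum

open Classical in
/-- The inner sum attached to `(μ, ν)` in the power sum identity for the inverse norm. -/
noncomputable def normSum (p Q : ℕ) (b : ℤ) (μ ν : ℕ) : ZMod p :=
  ∑ i ∈ range (Q - 1), ∑ j ∈ range (Q - 1),
    if ∃ r : ℤ, 0 < r ∧ r < 4 ∧ 2 * ((i : ℤ) + j) + μ + ν = r * (Q - 1) ∧
        2 * ((Q : ℤ) + 1) ∣ r * (Q + 1) + (ν - μ) - 2 * b * (i - j) then
      ((i : ZMod p) + 1) * (j + 1) else 0

theorem normSum_eq_sum {p Q : ℕ} {b : ℤ} {μ ν : ℕ} (S : Finset (ℕ × ℕ))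
    (hS : ∀ i j : ℕ, (i < Q - 1 ∧ j < Q - 1 ∧
      ∃ r : ℤ, 0 < r ∧ r < 4 ∧ 2 * ((i : ℤ) + j) + μ + ν = r * (Q - 1) ∧
        2 * ((Q : ℤ) + 1) ∣ r * (Q + 1) + (ν - μ) - 2 * b * (i - j)) ↔ (i, j) ∈ S) :
    normSum p Q b μ ν = ∑ x ∈ S, ((x.1 : ZMod p) + 1) * (x.2 + 1) := by
  classical
  unfold normSum
  rw [← Finset.sum_product', ← Finset.sum_filter]
  refine Finset.sum_congr ?_ fun _ _ => rfl
  ext ⟨i, j⟩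
  rw [← hS, mem_filter, mem_product, mem_range, mem_range, and_assoc]

theorem normSum_swap (p Q : ℕ) (b : ℤ) (μ ν : ℕ) : normSum p Q b μ ν = normSum p Q b ν μ := by
  classical
  unfold normSum
  rw [Finset.sum_comm]
  refine Finset.sum_congr rfl fun i _ => Finset.sum_congr rfl fun j _ => ?_
  refine if_congr (exists_congr fun r => and_congr_right fun _ => and_congr_right fun _ =>
    and_congr ⟨fun h => by linarith, fun h => by linarith⟩ ?_) (mul_comm _ _) rfl
  have : r * ((Q : ℤ) + 1) + (ν - μ) - 2 * b * (j - i) =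
    2 * ((Q : ℤ) + 1) * r - (r * (Q + 1) + (μ - ν) - 2 * b * (i - j)) := by ring
  rw [this]
  exact dvd_sub_right (dvd_mul_right _ _)

theorem choose_pow_sub_two {p Q m : ℕ} [hpf : Fact p.Prime] (hQp : Q = p ^ m) {i : ℕ} (hi : i + 1 < Q) :
    ((Q - 2).choose i : ZMod p) = (-1) ^ i * (i + 1) := by
  have h1 := Nat.choose_mul (n := Q - 1) (k := i + 1) (s := 1) (by omega)
  rw [Nat.choose_one_right, Nat.choose_one_right, Nat.add_sub_cancel, Nat.sub_sub] at h1
  have h2 := congrArg (Nat.cast (R := ZMod p)) h1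
  have h3 : ((Q - 1).choose (i + 1) : ZMod p) = (-1) ^ (i + 1) := by
    rw [hQp] at hi ⊢; exact choose_pow_sub_one m _ hi
  have h4 : ((Q : ℕ) : ZMod p) = 0 := by
    have hm : m ≠ 0 := by rintro rfl; rw [pow_zero] at hQp; omega
    rw [hQp]; simp [hm]
  push_cast [Nat.cast_sub (by omega : 1 ≤ Q)] at h2
  rw [h3, h4, pow_succ] at h2
  linear_combination h2

theorem planar_normSum_eq_zero (K : Type*) [Field K] [Fintype K] {p Q m : ℕ} [Fact p.Prime] [CharP K p]
    (hp2 : p ≠ 2) (hQp : Q = p ^ m) (hcard : Fintype.card K = Q ^ 2) (hQ : 2 < Q)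
    {D : ℕ} {b : ℤ} (hD : (Q : ℤ) ^ 2 - 1 ∣ D - (1 + Q) + b * (Q - 1)) (hD0 : D ≠ 0)
    (hpl : IsPlanarFunction fun x : K => x ^ D) :
    normSum p Q b 0 0 + normSum p Q b 2 2 + 4 * normSum p Q b 1 1 + 2 * normSum p Q b 0 2 = 0 := by
  classical
  have hmain := planar_sum_eq_zero K hQp hcard (by omega) hD hD0 hpl (A := Q - 2) (ε := 2) (c := 2)
    (by omega) (by omega) (by omega)
  have hterm : ∀ μ ν : ℕ, ∑ i ∈ range (Q - 2 + 1), ∑ j ∈ range (Q - 2 + 1),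
      (if ∃ r : ℤ, 0 < r ∧ r < 2 * (2 : ℕ) ∧ 2 * ((i : ℤ) + j) + μ + ν = r * (Q - 1) ∧
          2 * ((Q : ℤ) + 1) ∣ r * (Q + 1) + (ν - μ) - 2 * b * (i - j) then
        ((-1) ^ (i + j + μ + ν) * (Q - 2).choose i * (Q - 2).choose j * Nat.choose 2 μ * Nat.choose 2 ν : ZMod p)
      else 0) = (-1) ^ (μ + ν) * Nat.choose 2 μ * Nat.choose 2 ν * normSum p Q b μ ν := by
    intro μ ν
    unfold normSum
    rw [show Q - 2 + 1 = Q - 1 by omega]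
    simp only [Finset.mul_sum]
    refine Finset.sum_congr rfl fun i hi => Finset.sum_congr rfl fun j hj => ?_
    have hi' := mem_range.mp hi
    have hj' := mem_range.mp hj
    rw [mul_ite, mul_zero]
    refine if_congr (by norm_num) ?_ rfl
    rw [choose_pow_sub_two hQp (by omega), choose_pow_sub_two hQp (by omega)]
    have h1 : ∀ k : ℕ, (-1 : ZMod p) ^ k * (-1) ^ k = 1 := fun k => by rw [← mul_pow]; simp
    simp only [pow_add]
    linear_combination ((-1) ^ μ * (-1) ^ ν * ((i : ZMod p) + 1) * (j + 1) * Nat.choose 2 μ * Nat.choose 2 ν) *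
      ((-1) ^ j * (-1) ^ j * h1 i + h1 j)
  simp only [hterm] at hmain
  have hQodd : Odd Q := hQp ▸ ((Fact.out (p := p.Prime)).odd_of_ne_two hp2).pow
  have hz : ∀ μ ν : ℕ, (μ + ν) % 2 = 1 → normSum p Q b μ ν = 0 := by
    intro μ ν h
    rw [normSum_eq_sum ∅, Finset.sum_empty]
    intro i j
    simp only [notMem_empty, iff_false]
    rintro ⟨-, -, r, -, -, h1, -⟩
    obtain ⟨q, hq⟩ := hQodd
    have h2 : r * ((Q : ℤ) - 1) = 2 * (r * q) := by rw [hq]; push_cast; ring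
    omega
  simp only [sum_range_succ, sum_range_zero, zero_add, hz 0 1 rfl, hz 1 0 rfl, hz 1 2 rfl, hz 2 1 rfl,
    normSum_swap p Q b 2 0, mul_zero, add_zero] at hmain
  have c21 : Nat.choose 2 1 = 2 := rfl
  simp only [Nat.choose_self, Nat.choose_zero_right, c21] at hmain
  push_cast at hmain
  linear_combination hmain

theorem odd_normSum_condition {Q h b β : ℤ} (hh : Q + 1 = 2 * h) (hb : Q + 1 ∣ b * β - 1) (hb2 : b % 2 = 1)
    (hβ2 : β % 2 = 1) (r x z : ℤ) :
    2 * (Q + 1) ∣ r * (Q + 1) + 2 * x - 2 * b * z ↔ 2 * h ∣ r * h + β * x - z := by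
  obtain ⟨t, ht⟩ := hb
  obtain ⟨b', rfl⟩ : ∃ b', b = 2 * b' + 1 := ⟨b / 2, by omega⟩
  obtain ⟨β', rfl⟩ : ∃ β', β = 2 * β' + 1 := ⟨β / 2, by omega⟩
  rw [hh] at ht ⊢
  constructor
  · rintro ⟨u, hu⟩
    refine ⟨(2 * β' + 1) * u - β' * r + t * z, ?_⟩
    apply mul_left_cancel₀ (two_ne_zero' ℤ)
    linear_combination (2 * β' + 1) * hu + 2 * z * ht
  · rintro ⟨u, hu⟩
    refine ⟨(2 * b' + 1) * u - b' * r - t * x, ?_⟩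
    linear_combination 2 * (2 * b' + 1) * hu - 2 * x * ht

theorem even_normSum_condition {Q h b z₀ : ℤ} (hh : Q + 1 = 2 * h) (hho : h % 2 = 1) (hb : h ∣ b * z₀ - 1)
    (hb2 : b % 2 = 0) (r x z : ℤ) :
    2 * (Q + 1) ∣ r * (Q + 1) + 2 * x - 2 * b * z ↔ (r - x) % 2 = 0 ∧ h ∣ z - z₀ * x := by
  obtain ⟨t, ht⟩ := hb
  obtain ⟨b', rfl⟩ : ∃ b', b = 2 * b' := ⟨b / 2, by omega⟩
  obtain ⟨h', rfl⟩ : ∃ h', h = 2 * h' + 1 := ⟨h / 2, by omega⟩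
  rw [hh]
  constructor
  · rintro ⟨u, hu⟩
    have h1 : (2 * h' + 1) * r + x - 2 * b' * z = 2 * (2 * h' + 1) * u := by linarith
    constructor
    · have h2 : (2 * h' + 1) * r = 2 * (h' * r) + r := by ring
      have h3 : 2 * b' * z = 2 * (b' * z) := by ring
      have h4 : 2 * (2 * h' + 1) * u = 2 * ((2 * h' + 1) * u) := by ring
      omega
    · refine ⟨z₀ * r - 2 * z₀ * u - t * z, ?_⟩
      linear_combination -z₀ * h1 - z * ht
  · rintro ⟨h1, u, hu⟩
    obtain ⟨v, hv⟩ : ∃ v, r - x = 2 * v := ⟨(r - x) / 2, by omega⟩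
    have h2 : (2 * h' + 1) * r + x - 2 * b' * z = 2 * (v + h' * r + x - b' * z) := by
      linear_combination hv
    have h3 : 2 * h' + 1 ∣ 2 * (v + h' * r + x - b' * z) := by
      rw [← h2]
      exact ⟨r - 2 * b' * u - t * x, by linear_combination (-2 * b') * hu - x * ht⟩
    have h4 : IsCoprime (2 * h' + 1) 2 := ⟨1, -h', by ring⟩
    obtain ⟨w, hw⟩ := h4.dvd_of_dvd_mul_left h3
    exact ⟨w, by linear_combination 2 * h2 + 4 * hw⟩

theorem odd_inverse_mod_char {p Q h : ℕ} [Fact p.Prime] (hp2 : p ≠ 2) (hpQ : p ∣ Q) (hh : Q + 1 = 2 * h) {b : ℤ}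
    (hnorm : normSum p Q b 0 0 + normSum p Q b 2 2 + 4 * normSum p Q b 1 1 + 2 * normSum p Q b 0 2 = 0)
    {β' : ℕ} (hβ1 : 1 ≤ β') (hβQ : β' + 2 ≤ h)
    (hb : (Q : ℤ) + 1 ∣ b * (2 * β' + 1) - 1) (hb2 : b % 2 = 1) :
    p ∣ β' ∨ p ∣ 2 * β' + 1 := by
  have hhz : (Q : ℤ) + 1 = 2 * h := by exact_mod_cast hh
  have hcond := odd_normSum_condition hhz hb hb2 (by omega)
  have hQz : (Q : ℤ) - 1 = 2 * h - 2 := by omega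
  have h00 : normSum p Q b 0 0 = (h : ZMod p) * h := by
    rw [normSum_eq_sum {(h - 1, h - 1)}, sum_singleton]
    · push_cast [Nat.cast_sub (by omega : 1 ≤ h)]; ring
    · intro i j
      simp only [mem_singleton, Prod.mk.injEq]
      constructor
      · rintro ⟨hi, hj, r, hr0, hr4, hs, hd⟩
        rw [show ((0 : ℕ) : ℤ) - (0 : ℕ) = 2 * 0 by norm_num, hcond] at hd
        obtain ⟨k, hk⟩ := hd
        rw [hQz] at hs
        rcases mul_trichotomy (N := 2 * (h : ℤ)) (by omega) k with h' | h' | h' | h' <;>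
          interval_cases r <;> omega
      · rintro ⟨rfl, rfl⟩
        refine ⟨by omega, by omega, 2, by omega, by omega, by rw [hQz]; omega, ?_⟩
        rw [show ((0 : ℕ) : ℤ) - (0 : ℕ) = 2 * 0 by norm_num, hcond]
        exact ⟨1, by ring⟩
  have h22 : normSum p Q b 2 2 = ((h : ZMod p) - 1) * (h - 1) := by
    rw [normSum_eq_sum {(h - 2, h - 2)}, sum_singleton]
    · push_cast [Nat.cast_sub (by omega : 2 ≤ h)]; ring
    · intro i j
      simp only [mem_singleton, Prod.mk.injEq]
      constructor
      · rintro ⟨hi, hj, r, hr0, hr4, hs, hd⟩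
        rw [show ((2 : ℕ) : ℤ) - (2 : ℕ) = 2 * 0 by norm_num, hcond] at hd
        obtain ⟨k, hk⟩ := hd
        rw [hQz] at hs
        rcases mul_trichotomy (N := 2 * (h : ℤ)) (by omega) k with h' | h' | h' | h' <;>
          interval_cases r <;> omega
      · rintro ⟨rfl, rfl⟩
        refine ⟨by omega, by omega, 2, by omega, by omega, by rw [hQz]; omega, ?_⟩
        rw [show ((2 : ℕ) : ℤ) - (2 : ℕ) = 2 * 0 by norm_num, hcond]
        exact ⟨1, by ring⟩
  have h11 : normSum p Q b 1 1 = 0 := by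
    rw [normSum_eq_sum ∅, sum_empty]
    intro i j
    simp only [notMem_empty, iff_false]
    rintro ⟨hi, hj, r, hr0, hr4, hs, hd⟩
    rw [show ((1 : ℕ) : ℤ) - (1 : ℕ) = 2 * 0 by norm_num, hcond] at hd
    obtain ⟨k, hk⟩ := hd
    rw [hQz] at hs
    rcases mul_trichotomy (N := 2 * (h : ℤ)) (by omega) k with h' | h' | h' | h' <;>
      interval_cases r <;> omega
  have h02 : normSum p Q b 0 2 = ((h : ZMod p) + β') * (h - 1 - β') + β' * (2 * h - 1 - β') := by
    rw [normSum_eq_sum {(h - 1 + β', h - 2 - β'), (β' - 1, 2 * h - 2 - β')}, sum_pair]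
    · push_cast [Nat.cast_sub (by omega : 1 ≤ h), Nat.cast_sub (by omega : β' ≤ h - 2),
        Nat.cast_sub (by omega : 2 ≤ h), Nat.cast_sub hβ1, Nat.cast_sub (by omega : β' ≤ 2 * h - 2),
        Nat.cast_sub (by omega : 2 ≤ 2 * h)]
      ring
    · simp only [ne_eq, Prod.mk.injEq, not_and]
      omega
    · intro i j
      simp only [mem_insert, mem_singleton, Prod.mk.injEq]
      constructor
      · rintro ⟨hi, hj, r, hr0, hr4, hs, hd⟩
        rw [show ((2 : ℕ) : ℤ) - (0 : ℕ) = 2 * 1 by norm_num, hcond] at hd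
        obtain ⟨k, hk⟩ := hd
        rw [hQz] at hs
        rw [show 2 * (h : ℤ) * k = 2 * h * (k - 1) + 2 * h by ring] at hk
        rcases mul_trichotomy (N := 2 * (h : ℤ)) (by omega) (k - 1) with h' | h' | h' | h' <;>
          interval_cases r <;> omega
      · rintro (⟨rfl, rfl⟩ | ⟨rfl, rfl⟩)
        · refine ⟨by omega, by omega, 2, by omega, by omega, by rw [hQz]; omega, ?_⟩
          rw [show ((2 : ℕ) : ℤ) - (0 : ℕ) = 2 * 1 by norm_num, hcond]
          exact ⟨1, by omega⟩
        · refine ⟨by omega, by omega, 2, by omega, by omega, by rw [hQz]; omega, ?_⟩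
          rw [show ((2 : ℕ) : ℤ) - (0 : ℕ) = 2 * 1 by norm_num, hcond]
          exact ⟨2, by omega⟩
  have h2h : (2 * h : ZMod p) = 1 := by
    have h1 : ((Q + 1 : ℕ) : ZMod p) = ((2 * h : ℕ) : ZMod p) := by rw [hh]
    push_cast at h1
    rw [(ZMod.natCast_eq_zero_iff Q p).mpr hpQ] at h1
    linear_combination -h1
  rw [h00, h22, h11, h02] at hnorm
  have h2 : (2 : ZMod p) ≠ 0 := by
    have hp : p.Prime := Fact.out
    have := hp.two_le
    exact_mod_cast natCast_zmod_ne_zero (p := p) (n := 2) (by omega) (by omega)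
  have h3 : (2 : ZMod p) * (2 * (2 * ((β' : ZMod p) * (2 * β' + 1)))) = 0 := by
    linear_combination (-4) * hnorm + (8 * h - 4 + 8 * β') * h2h
  have h4 := (mul_eq_zero.mp ((mul_eq_zero.mp ((mul_eq_zero.mp h3).resolve_left h2)).resolve_left h2)).resolve_left h2
  rcases mul_eq_zero.mp h4 with h5 | h5
  · left; exact (ZMod.natCast_eq_zero_iff _ _).mp h5
  · right
    refine (ZMod.natCast_eq_zero_iff _ _).mp ?_
    push_cast; exact h5

end NormSum

theorem even_inverse_mod_char {p Q h : ℕ} [Fact p.Prime] (hp2 : p ≠ 2) (hpQ : p ∣ Q) (hh : Q + 1 = 2 * h) {b : ℤ}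
    (hnorm : normSum p Q b 0 0 + normSum p Q b 2 2 + 4 * normSum p Q b 1 1 + 2 * normSum p Q b 0 2 = 0)
    {h' : ℕ} (hh' : h = 2 * h' + 1) (hh1 : 1 ≤ h') {ζ : ℤ} (hζ1 : -h' ≤ ζ) (hζ2 : ζ < h')
    (hb : (h : ℤ) ∣ b * (2 * ζ + 1) - 1) (hb2 : b % 2 = 0) :
    (p : ℤ) ∣ 4 * ζ + 1 ∨ (p : ℤ) ∣ 4 * ζ + 3 := by
  have hhz : (Q : ℤ) + 1 = 2 * h := by exact_mod_cast hh
  have hcond := even_normSum_condition hhz (by omega) hb hb2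
  have hQz : (Q : ℤ) - 1 = 4 * h' := by omega
  have h00 : normSum p Q b 0 0 = (2 * h' + 1 : ZMod p) * (2 * h' + 1) := by
    rw [normSum_eq_sum {(2 * h', 2 * h')}, sum_singleton]
    · push_cast; ring
    · intro i j
      simp only [mem_singleton, Prod.mk.injEq]
      constructor
      · rintro ⟨hi, hj, r, hr0, hr4, hs, hd⟩
        rw [show ((0 : ℕ) : ℤ) - (0 : ℕ) = 2 * 0 by norm_num, hcond] at hd
        obtain ⟨hr, k, hk⟩ := hd
        rw [hQz] at hs
        have hr2 : r = 2 := by omega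
        subst hr2
        rcases mul_trichotomy (N := (h : ℤ)) (by omega) k with h' | h' | h' | h'
        · have := mul_trichotomy (N := (h : ℤ)) (by omega) (k + 1)
          rw [mul_add, mul_one] at this
          omega
        · omega
        · omega
        · omega
      · rintro ⟨rfl, rfl⟩
        refine ⟨by omega, by omega, 2, by omega, by omega, by rw [hQz]; push_cast; ring, ?_⟩
        rw [show ((0 : ℕ) : ℤ) - (0 : ℕ) = 2 * 0 by norm_num, hcond]
        exact ⟨by norm_num, 0, by ring⟩
  have h22 : normSum p Q b 2 2 = (2 * h' : ZMod p) * (2 * h') := by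
    rw [normSum_eq_sum {(2 * h' - 1, 2 * h' - 1)}, sum_singleton]
    · push_cast [Nat.cast_sub (by omega : 1 ≤ 2 * h')]; ring
    · intro i j
      simp only [mem_singleton, Prod.mk.injEq]
      constructor
      · rintro ⟨hi, hj, r, hr0, hr4, hs, hd⟩
        rw [show ((2 : ℕ) : ℤ) - (2 : ℕ) = 2 * 0 by norm_num, hcond] at hd
        obtain ⟨hr, k, hk⟩ := hd
        rw [hQz] at hs
        have hr2 : r = 2 := by omega
        subst hr2
        rcases mul_trichotomy (N := (h : ℤ)) (by omega) k with h' | h' | h' | h'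
        · have := mul_trichotomy (N := (h : ℤ)) (by omega) (k + 1)
          rw [mul_add, mul_one] at this
          omega
        · omega
        · omega
        · omega
      · rintro ⟨rfl, rfl⟩
        refine ⟨by omega, by omega, 2, by omega, by omega, by rw [hQz]; omega, ?_⟩
        rw [show ((2 : ℕ) : ℤ) - (2 : ℕ) = 2 * 0 by norm_num, hcond]
        exact ⟨by norm_num, 0, by ring⟩
  have h11 : normSum p Q b 1 1 = 2 * ((3 * h' + 1 : ZMod p) * h') := by
    rw [normSum_eq_sum {(3 * h', h' - 1), (h' - 1, 3 * h')}, sum_pair]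
    · push_cast [Nat.cast_sub hh1]; ring
    · simp only [ne_eq, Prod.mk.injEq, not_and]
      omega
    · intro i j
      simp only [mem_insert, mem_singleton, Prod.mk.injEq]
      constructor
      · rintro ⟨hi, hj, r, hr0, hr4, hs, hd⟩
        rw [show ((1 : ℕ) : ℤ) - (1 : ℕ) = 2 * 0 by norm_num, hcond] at hd
        obtain ⟨hr, k, hk⟩ := hd
        rw [hQz] at hs
        have hr2 : r = 2 := by omega
        subst hr2
        rcases mul_trichotomy (N := (h : ℤ)) (by omega) k with h' | h' | h' | h'
        · have := mul_trichotomy (N := (h : ℤ)) (by omega) (k + 1)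
          rw [mul_add, mul_one] at this
          omega
        · omega
        · omega
        · omega
      · rintro (⟨rfl, rfl⟩ | ⟨rfl, rfl⟩)
        · refine ⟨by omega, by omega, 2, by omega, by omega, by rw [hQz]; omega, ?_⟩
          rw [show ((1 : ℕ) : ℤ) - (1 : ℕ) = 2 * 0 by norm_num, hcond]
          exact ⟨by norm_num, 1, by omega⟩
        · refine ⟨by omega, by omega, 2, by omega, by omega, by rw [hQz]; omega, ?_⟩
          rw [show ((1 : ℕ) : ℤ) - (1 : ℕ) = 2 * 0 by norm_num, hcond]
          exact ⟨by norm_num, -1, by omega⟩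
  obtain ⟨i₁, hi₁⟩ : ∃ i₁ : ℕ, (i₁ : ℤ) = h' + ζ := ⟨(h' + ζ).toNat, by omega⟩
  obtain ⟨j₁, hj₁⟩ : ∃ j₁ : ℕ, (j₁ : ℤ) = h' - ζ - 1 := ⟨(h' - ζ - 1).toNat, by omega⟩
  obtain ⟨i₂, hi₂⟩ : ∃ i₂ : ℕ, (i₂ : ℤ) = 3 * h' + ζ := ⟨(3 * h' + ζ).toNat, by omega⟩
  obtain ⟨j₂, hj₂⟩ : ∃ j₂ : ℕ, (j₂ : ℤ) = 3 * h' - ζ - 1 := ⟨(3 * h' - ζ - 1).toNat, by omega⟩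
  have h02 : normSum p Q b 0 2 = (h' + ζ + 1 : ZMod p) * (h' - ζ) + (3 * h' + ζ + 1) * (3 * h' - ζ) := by
    rw [normSum_eq_sum {(i₁, j₁), (i₂, j₂)}, sum_pair]
    · have e1 := congrArg (Int.cast (R := ZMod p)) hi₁
      have e2 := congrArg (Int.cast (R := ZMod p)) hj₁
      have e3 := congrArg (Int.cast (R := ZMod p)) hi₂
      have e4 := congrArg (Int.cast (R := ZMod p)) hj₂
      push_cast at e1 e2 e3 e4
      simp only [e1, e2, e3, e4]
      ring
    · simp only [ne_eq, Prod.mk.injEq, not_and]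
      omega
    · intro i j
      simp only [mem_insert, mem_singleton, Prod.mk.injEq]
      constructor
      · rintro ⟨hi, hj, r, hr0, hr4, hs, hd⟩
        rw [show ((2 : ℕ) : ℤ) - (0 : ℕ) = 2 * 1 by norm_num, hcond] at hd
        obtain ⟨hr, k, hk⟩ := hd
        rw [hQz] at hs
        have hr13 : r = 1 ∨ r = 3 := by omega
        rcases hr13 with rfl | rfl <;>
        rcases mul_trichotomy (N := (h : ℤ)) (by omega) k with h' | h' | h' | h'
        all_goals first
          | omega
          | (have := mul_trichotomy (N := (h : ℤ)) (by omega) (k + 1)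
             rw [mul_add, mul_one] at this
             omega)
      · rintro (⟨rfl, rfl⟩ | ⟨rfl, rfl⟩)
        · refine ⟨by omega, by omega, 1, by omega, by omega, by rw [hQz]; omega, ?_⟩
          rw [show ((2 : ℕ) : ℤ) - (0 : ℕ) = 2 * 1 by norm_num, hcond]
          exact ⟨by norm_num, 0, by omega⟩
        · refine ⟨by omega, by omega, 3, by omega, by omega, by rw [hQz]; omega, ?_⟩
          rw [show ((2 : ℕ) : ℤ) - (0 : ℕ) = 2 * 1 by norm_num, hcond]
          exact ⟨by norm_num, 0, by omega⟩
  have h4h : (4 * h' : ZMod p) = -1 := by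
    have h1 : ((Q + 1 : ℕ) : ZMod p) = ((2 * (2 * h' + 1) : ℕ) : ZMod p) := by rw [hh, hh']
    push_cast at h1
    rw [(ZMod.natCast_eq_zero_iff Q p).mpr hpQ] at h1
    linear_combination -h1
  rw [h00, h22, h11, h02] at hnorm
  have h2 : (2 : ZMod p) ≠ 0 := by
    have hp : p.Prime := Fact.out
    have := hp.two_le
    exact_mod_cast natCast_zmod_ne_zero (p := p) (n := 2) (by omega) (by omega)
  have hkey : (2 ^ 2 : ZMod p) * ((4 * ζ + 1) * (4 * ζ + 3)) = 0 := by
    linear_combination (-16) * hnorm + (52 * (4 * h' : ZMod p) + 28) * h4h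
  have h4 := (mul_eq_zero.mp hkey).resolve_left (pow_ne_zero _ h2)
  rcases mul_eq_zero.mp h4 with h5 | h5
  · left
    refine (ZMod.intCast_zmod_eq_zero_iff_dvd _ p).mp ?_
    push_cast; exact h5
  · right
    refine (ZMod.intCast_zmod_eq_zero_iff_dvd _ p).mp ?_
    push_cast; exact h5

theorem exists_nat_inverse {b N : ℤ} (hN : 0 < N) (h : IsCoprime b N) : ∃ k : ℕ, (k : ℤ) < N ∧ N ∣ b * k - 1 := by
  obtain ⟨u, v, huv⟩ := h
  refine ⟨(u % N).toNat, ?_, ?_⟩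
  · rw [Int.toNat_of_nonneg (Int.emod_nonneg _ hN.ne')]; exact Int.emod_lt_of_pos _ hN
  · rw [Int.toNat_of_nonneg (Int.emod_nonneg _ hN.ne')]
    refine ⟨-(b * (u / N)) - v, ?_⟩
    have := Int.emod_add_mul_ediv u N
    linear_combination b * this + huv

theorem odd_exponent_false {p Q l : ℕ} [Fact p.Prime] (hp5 : 5 < p) (hQl : Q = p ^ (l + 1)) {b : ℤ}
    (H : PlanarIdentities p Q b) (H' : PlanarIdentities p Q (-b))
    (hnorm : normSum p Q b 0 0 + normSum p Q b 2 2 + 4 * normSum p Q b 1 1 + 2 * normSum p Q b 0 2 = 0)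
    (hb1 : ¬ (Q : ℤ) + 1 ∣ b - 1) (hb2 : ¬ (Q : ℤ) + 1 ∣ b + 1) (hbo : b % 2 = 1) : False := by
  have hpp : p.Prime := Fact.out
  obtain ⟨q, hq⟩ : Odd Q := hQl ▸ (hpp.odd_of_ne_two (by omega)).pow
  have hh : Q + 1 = 2 * (q + 1) := by omega
  have hhz : (Q : ℤ) + 1 = 2 * ((q + 1 : ℕ) : ℤ) := by exact_mod_cast hh
  have hQL : Q = p * p ^ l := by rw [hQl, pow_succ']
  have hcop : IsCoprime b ((Q : ℤ) + 1) := by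
    rw [hhz]
    refine IsCoprime.mul_right ⟨1, -(b / 2), by omega⟩ (H.coprime _ hhz)
  obtain ⟨β, hβ, hbβ⟩ := exists_nat_inverse (by omega) hcop
  have hβo : β % 2 = 1 := by
    obtain ⟨t, ht⟩ := hbβ
    obtain ⟨b', rfl⟩ : ∃ b', b = 2 * b' + 1 := ⟨b / 2, by omega⟩
    have h1 : (2 * b' + 1) * (β : ℤ) = 2 * (b' * β) + β := by ring
    have h2 : ((Q : ℤ) + 1) * t = 2 * (((q : ℤ) + 1) * t) := by rw [hhz]; push_cast; ring
    omega
  obtain ⟨β', hβ'⟩ : ∃ β', β = 2 * β' + 1 := ⟨β / 2, by omega⟩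
  have hβz : (β : ℤ) = 2 * β' + 1 := by exact_mod_cast hβ'
  rw [hβz] at hbβ
  have hne1 : β' ≠ 0 := by
    rintro rfl
    apply hb1
    convert hbβ using 1
    push_cast; ring
  have hneQ : β' ≠ q := by
    rintro rfl
    apply hb2
    have h1 : b + 1 = b * (Q + 1) - (b * (2 * β' + 1) - 1) := by rw [hq]; push_cast; ring
    rw [h1]
    exact dvd_sub (dvd_mul_left _ _) hbβ
  have hbound : ∀ γ, 2 * (p * γ) < Q → 2 * γ < p ^ l := by
    intro γ hγ
    rw [hQL] at hγ
    by_contra hcon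
    have := Nat.mul_le_mul_left p (not_lt.mp hcon)
    rw [mul_left_comm] at this
    omega
  rcases odd_inverse_mod_char (by omega) ⟨_, hQL⟩ hh hnorm (by omega) (by omega) hbβ hbo with hd | hd
  · obtain ⟨γ, rfl⟩ := hd
    refine odd_case_false hp5 hQl H hhz (γ := γ) (Nat.pos_of_ne_zero fun h => hne1 (by rw [h, mul_zero]))
      (hbound γ (by omega)) ?_
    convert hbβ using 2
    push_cast; ring
  · have hd2 : p ∣ q - β' := by
      have h1 : p ∣ 2 * (q - β') := by
        have h2 : 2 * (q - β') + (2 * β' + 1) = Q := by omega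
        exact (Nat.dvd_add_left hd).mp (h2 ▸ ⟨_, hQL⟩)
      rcases hpp.dvd_mul.mp h1 with h | h
      · exact absurd (Nat.le_of_dvd two_pos h) (by omega)
      · exact h
    obtain ⟨γ, hγ⟩ := hd2
    refine odd_case_false hp5 hQl H' hhz (γ := γ) (Nat.pos_of_ne_zero fun h => by rw [h, mul_zero] at hγ; omega)
      (hbound γ (by omega)) ?_
    have h3 : (p : ℤ) * γ = q - β' := by
      have := congrArg (Nat.cast (R := ℤ)) hγ
      push_cast [Nat.cast_sub (by omega : β' ≤ q)] at this
      linarith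
    have h1 : -b * (1 + 2 * p * γ) - 1 = (b * (2 * β' + 1) - 1) - b * (Q + 1) := by
      rw [hq]; push_cast
      linear_combination (-2 * b) * h3
    rw [h1]
    exact dvd_sub hbβ (dvd_mul_left _ _)

theorem even_exponent_false {p Q l : ℕ} [Fact p.Prime] (hp5 : 5 < p) (hQl : Q = p ^ (l + 1)) {b : ℤ}
    (H : PlanarIdentities p Q b) (H' : PlanarIdentities p Q (-b))
    (hnorm : normSum p Q b 0 0 + normSum p Q b 2 2 + 4 * normSum p Q b 1 1 + 2 * normSum p Q b 0 2 = 0)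
    (hbe : b % 2 = 0) : False := by
  have hpp : p.Prime := Fact.out
  obtain ⟨q, hq⟩ : Odd Q := hQl ▸ (hpp.odd_of_ne_two (by omega)).pow
  have hh : Q + 1 = 2 * (q + 1) := by omega
  have hhz : (Q : ℤ) + 1 = 2 * ((q + 1 : ℕ) : ℤ) := by exact_mod_cast hh
  have hQL : Q = p * p ^ l := by rw [hQl, pow_succ']
  have hpQ : p ≤ Q := by
    rw [hQL]; exact Nat.le_mul_of_pos_right _ (pow_pos hpp.pos _)
  have hcop := H.coprime _ hhz
  have hho : (q + 1) % 2 = 1 := by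
    obtain ⟨u, v, huv⟩ := hcop
    obtain ⟨b', rfl⟩ : ∃ b', b = 2 * b' := ⟨b / 2, by omega⟩
    by_contra hcon
    obtain ⟨q', hq'⟩ : ∃ q', q + 1 = 2 * q' := ⟨(q + 1) / 2, by omega⟩
    rw [hq'] at huv
    push_cast at huv
    have h1 : u * (2 * b') + v * (2 * q') = 2 * (u * b' + v * q') := by ring
    omega
  obtain ⟨h', hh'⟩ : ∃ h', q + 1 = 2 * h' + 1 := ⟨(q + 1) / 2, by omega⟩
  obtain ⟨k, hk, hbk⟩ := exists_nat_inverse (by omega) hcop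
  have hkpos : k ≠ 0 := by
    rintro rfl
    have h1 : ((q + 1 : ℕ) : ℤ) ∣ 1 := by
      have := dvd_neg.mpr hbk
      simpa using this
    have := Int.le_of_dvd one_pos h1
    omega
  obtain ⟨ζ, hζ1, hζ2, hbζ⟩ : ∃ ζ : ℤ, -h' ≤ ζ ∧ ζ < h' ∧ ((q + 1 : ℕ) : ℤ) ∣ b * (2 * ζ + 1) - 1 := by
    rcases Nat.even_or_odd' k with ⟨k', hk' | hk'⟩
    · refine ⟨k' - h' - 1, by omega, by omega, ?_⟩
      have h1 : b * (2 * ((k' : ℤ) - h' - 1) + 1) - 1 = (b * k - 1) - b * (q + 1 : ℕ) := by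
        rw [hk', hh']; push_cast; ring
      rw [h1]
      exact dvd_sub hbk (dvd_mul_left _ _)
    · refine ⟨k', by omega, by omega, ?_⟩
      convert hbk using 2
      rw [hk']; push_cast; ring
  have finish : ∀ (b₁ : ℤ) (g : ℕ), PlanarIdentities p Q b₁ → b₁ % 2 = 0 → 0 < g → 2 * g < Q + 1 → p ∣ 4 * g →
      ((q + 1 : ℕ) : ℤ) ∣ b₁ * (2 * g) - 1 → False := by
    intro b₁ g H₁ hb₁ hg0 hgQ hpg hdvd
    have hpg' : p ∣ g := by
      rcases hpp.dvd_mul.mp hpg with h | h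
      · exact absurd (Nat.le_of_dvd (by norm_num) h) (by omega)
      · exact h
    obtain ⟨γ, rfl⟩ := hpg'
    have hγ : 0 < γ := Nat.pos_of_ne_zero fun h => by rw [h, mul_zero] at hg0; omega
    have hdvd' : ((q + 1 : ℕ) : ℤ) ∣ b₁ * (2 * p * γ) - 1 := by
      convert hdvd using 2
      push_cast; ring
    rw [← mul_assoc] at hgQ
    have hp4 : p % 4 = 1 ∨ p % 4 = 3 := by
      have := hpp.eq_two_or_odd
      omega
    rcases hp4 with h | h
    · exact even_case_false_of_one_mod_four hp5 h hQl H₁ hhz (by omega) hb₁ hγ hgQ hdvd'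
    · exact even_case_false_of_three_mod_four hp5 h hQl H₁ hhz (by omega) hb₁ hgQ hdvd'
  have hpQz : (p : ℤ) ∣ Q := by exact_mod_cast (⟨_, hQL⟩ : p ∣ Q)
  rcases even_inverse_mod_char (by omega) ⟨_, hQL⟩ hh hnorm hh' (by omega) hζ1 hζ2 hbζ hbe with hd | hd
  · obtain ⟨g, hg⟩ : ∃ g : ℕ, (g : ℤ) = h' - ζ := ⟨(h' - ζ).toNat, by omega⟩
    refine finish (-b) g H' (by omega) (by omega) (by omega) ?_ ?_
    · have h1 : ((4 * g : ℕ) : ℤ) = Q - (4 * ζ + 1) := by omega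
      have h2 : (p : ℤ) ∣ ((4 * g : ℕ) : ℤ) := by rw [h1]; exact dvd_sub hpQz hd
      exact_mod_cast h2
    · have h1 : -b * (2 * g) - 1 = (b * (2 * ζ + 1) - 1) - b * (q + 1 : ℕ) := by
        rw [hg, hh']; push_cast; ring
      rw [h1]
      exact dvd_sub hbζ (dvd_mul_left _ _)
  · obtain ⟨g, hg⟩ : ∃ g : ℕ, (g : ℤ) = h' + ζ + 1 := ⟨(h' + ζ + 1).toNat, by omega⟩
    refine finish b g H hbe (by omega) (by omega) ?_ ?_
    · have h1 : ((4 * g : ℕ) : ℤ) = Q + (4 * ζ + 3) := by omega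
      have h2 : (p : ℤ) ∣ ((4 * g : ℕ) : ℤ) := by rw [h1]; exact dvd_add hpQz hd
      exact_mod_cast h2
    · have h1 : b * (2 * g) - 1 = (b * (2 * ζ + 1) - 1) + b * (q + 1 : ℕ) := by
        rw [hg, hh']; push_cast; ring
      rw [h1]
      exact dvd_add hbζ (dvd_mul_left _ _)

/-- A monomial whose exponent is `(1 + Q) - b (Q - 1)` modulo `Q ^ 2 - 1` is not planar over the field with
`Q ^ 2` elements unless `b` is `1` or `-1` modulo `Q + 1`. -/
theorem not_planar_of_exponent_congruence (K : Type*) [Field K] [Fintype K] {p Q l : ℕ} [Fact p.Prime] [CharP K p]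
    (hp5 : 5 < p) (hQl : Q = p ^ (l + 1)) (hcard : Fintype.card K = Q ^ 2) {D : ℕ} (hD0 : D ≠ 0) {b : ℤ}
    (hD : (Q : ℤ) ^ 2 - 1 ∣ D - (1 + Q) + b * (Q - 1))
    (hb1 : ¬ (Q : ℤ) + 1 ∣ b - 1) (hb2 : ¬ (Q : ℤ) + 1 ∣ b + 1) :
    ¬ IsPlanarFunction fun x : K => x ^ D := by
  intro hpl
  have hpp : p.Prime := Fact.out
  have hQ : 2 < Q := by
    have : p ≤ Q := by
      rw [hQl, pow_succ']; exact Nat.le_mul_of_pos_right _ (pow_pos hpp.pos _)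
    omega
  have H := planarIdentities_of_planar K (by omega) hQl hcard (by omega) hD hD0 hpl
  have hD' : (Q : ℤ) ^ 2 - 1 ∣ (D * Q : ℕ) - (1 + Q) + (-b) * (Q - 1) := by
    have h1 : ((D * Q : ℕ) : ℤ) - (1 + Q) + (-b) * (Q - 1) =
        Q * (D - (1 + Q) + b * (Q - 1)) + (Q ^ 2 - 1) * (1 - b) := by push_cast; ring
    rw [h1]
    exact dvd_add (hD.mul_left _) (dvd_mul_right _ _)
  have hpl' : IsPlanarFunction fun x : K => x ^ (D * Q) := by
    rw [hQl]; exact hpl.pow_mul_char_pow p (l + 1)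
  have H' := planarIdentities_of_planar K (by omega) hQl hcard (by omega) hD'
    (Nat.mul_ne_zero hD0 (by omega)) hpl'
  have hnorm := planar_normSum_eq_zero K (by omega) hQl hcard hQ hD hD0 hpl
  rcases Int.emod_two_eq_zero_or_one b with h | h
  · exact even_exponent_false hp5 hQl H H' hnorm h
  · exact odd_exponent_false hp5 hQl H H' hnorm hb1 hb2 h

theorem ofDigits_ofFn_add_complement (p s : ℕ) (u : Fin s → Fin p) :
    Nat.ofDigits p (List.ofFn fun i => (u i : ℕ)) + Nat.ofDigits p (List.ofFn fun i => p - 1 - (u i : ℕ)) + 1 =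
      p ^ s := by
  induction s with
  | zero => simp
  | succ s ih =>
    have h1 := ih fun i => u i.succ
    rw [List.ofFn_succ, List.ofFn_succ, Nat.ofDigits_cons, Nat.ofDigits_cons, pow_succ', ← h1]
    have h2 := (u 0).isLt
    obtain ⟨c, hc⟩ : ∃ c, p - 1 - (u 0 : ℕ) = c := ⟨_, rfl⟩
    have h3 : (u 0 : ℕ) + c + 1 = p := by omega
    rw [hc]
    linear_combination h3

theorem exponentD_eq (p r s : ℕ) (t : Fin p) (ht : (t : ℕ) ≠ 0) (u : Fin s → Fin p) :
    ∃ a c : ℕ, 0 < a ∧ 0 < c ∧ a + c = p ^ (r + s + 1) ∧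
      exponentD p r s t u = a + p ^ (r + s + 1) + p ^ (r + s + 2) * c := by
  have hsum := ofDigits_ofFn_add_complement p s u
  set U := Nat.ofDigits p (List.ofFn fun i => (u i : ℕ))
  set U' := Nat.ofDigits p (List.ofFn fun i => p - 1 - (u i : ℕ))
  have htp := t.isLt
  have hp0 : 0 < p := by omega
  refine ⟨p ^ r * (t + p * U), p ^ r * ((p - t) + p * U'), ?_, ?_, ?_, ?_⟩
  · exact Nat.mul_pos (pow_pos hp0 r) (by omega)
  · exact Nat.mul_pos (pow_pos hp0 r) (by omega)
  · obtain ⟨c, hc⟩ : ∃ c, p - (t : ℕ) = c := ⟨_, rfl⟩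
    have h3 : (t : ℕ) + c = p := by omega
    rw [hc, show r + s + 1 = r + (1 + s) by ring, pow_add, pow_add, pow_one, ← hsum]
    linear_combination p ^ r * h3
  · simp only [exponentD, exponentDigits, Nat.ofDigits_append, Nat.ofDigits_replicate_zero, Nat.ofDigits_singleton,
      List.length_append, List.length_replicate, List.length_singleton, List.length_ofFn, mul_zero, add_zero, zero_add,
      mul_one]
    simp only [pow_add, pow_one]
    ring

theorem mainTheorem4 (p : ℕ) (hp : p.Prime) (hp5 : 5 < p)
    (n m r s : ℕ) (hn : n = 2 * m) (hm : r + s + 2 = m)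
    (K : Type*) [Field K] [Finite K] (hK : Nat.card K = p ^ n)
    (t : Fin p) (ht : (t : ℕ) ≠ 0) (u : Fin s → Fin p) :
    ¬ IsPlanarPolynomial (Polynomial.X ^ exponentD p r s t u : Polynomial K) := by
  intro hpl
  have : Fact p.Prime := ⟨hp⟩
  have : Fintype K := Fintype.ofFinite K
  have hcard : Fintype.card K = p ^ n := by rw [← Nat.card_eq_fintype_card, hK]
  have : CharP K p := charP_of_card_eq_prime_pow hcard
  obtain ⟨a, c, ha, hc, hac, hd⟩ := exponentD_eq p r s t ht u
  have hpl₁ : IsPlanarFunction fun x : K => x ^ exponentD p r s t u := by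
    simpa only [IsPlanarPolynomial, Polynomial.eval_pow, Polynomial.eval_X] using hpl
  have hpl₂ := hpl₁.pow_mul_char_pow p 1
  have hQL : p ^ (r + s + 1 + 1) = p * p ^ (r + s + 1) := pow_succ' _ _
  have hlt : p * a < p ^ (r + s + 1 + 1) := by
    rw [hQL]; exact Nat.mul_lt_mul_of_pos_left (by omega) hp.pos
  have hpa : p * 1 ≤ p * a := Nat.mul_le_mul_left _ ha
  refine not_planar_of_exponent_congruence K hp5 (Q := p ^ (r + s + 1 + 1)) rfl
    (by rw [hcard, hn, ← hm, ← pow_mul]; congr 1; ring) ?_ (b := ((p * a : ℕ) : ℤ)) ?_ ?_ ?_ hpl₂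
  · exact Nat.mul_ne_zero (by rw [hd]; omega) (by rw [pow_one]; exact hp.ne_zero)
  · refine ⟨1, ?_⟩
    rw [hd, hQL]
    have hcz : (c : ℤ) = (p : ℤ) ^ (r + s + 1) - a := by
      have := congrArg (Nat.cast (R := ℤ)) hac
      push_cast at this
      linarith
    push_cast
    rw [hcz]
    ring
  · intro hdv
    have := Int.le_of_dvd (by omega) hdv
    omega
  · intro hdv
    have := Int.le_of_dvd (by omega) hdv
    omega
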